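/- All graphs are finite connected multigraphs $\Gamma=(V,E)$ (loops and multiple edges are allowed) all of whose vertices have valence at least $2$, a loop counting twice in the valence of its vertex. Put $b=b_1(\Gamma)=|E|-|V|+1$ and assume $b\ge 2$. A weight function on $\Gamma$ is a function $w:E\to\mathbb{R}_{\ge 0}$ such that, for an orientation of the edges, the symmetric bilinear form on the space $\mathbb{R}^E$ of real $1$-chains defined by $\langle e,e'\rangle_w=w(e)\,\delta_{e,e'}$ is positive definite on the space of cycles $H_1(\Gamma,\mathbb{R})\subset\mathbb{R}^E$ (this is automatic if all weights are positive). The Jacobian $\Lambda(\Gamma,w)$ is the lattice $H_1(\Gamma,\mathbb{Z})$ in the $b$-dimensional Euclidean space $(H_1(\Gamma,\mathbb{R}),\langle\cdot,\cdot\rangle_w)$. The Hermite invariant of a lattice $\Lambda$ in a Euclidean space of dimension $n$ is $\mu(\Lambda)=\min_{\lambda\in\Lambda\setminus\{0\}}\langle\lambda,\lambda\rangle\,/\,\det(\Lambda)^{1/n}$, where $\det(\Lambda)$ is the square of the volume of a fundamental domain of $\Lambda$. The systole $\mathrm{sys}(\Gamma)$ is the least number of edges of a simple circuit of $\Gamma$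 (a loop being a circuit of length $1$ and two parallel edges one of length $2$), and the complexity $\kappa(\Gamma)$ is the number of spanning trees of $\Gamma$. **(1)** For every orientation of the edges of $\Gamma$ and every weight function $w$ on $\Gamma$, $$\mu(\Lambda(\Gamma,w))\le 4\left(\prod_{k=2}^{b}\log_2\left(\tfrac{8}{3}k\right)\right)^{1/b}.$$ **(2)** If every vertex of $\Gamma$ has valence $2$ or $3$, then $$\kappa(\Gamma)\ge\frac{\mathrm{sys}(\Gamma)^b}{4^b\prod_{k=2}^{b}\log_2\left(\frac{8}{3}k\right)}.$$ -/

import Mathlib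

open scoped Graph RealInnerProductSpace

noncomputable section

/-! ## Lattices in Euclidean spaces -/

section Hermite

variable {E : Type*} [NormedAddCommGroup E] [InnerProductSpace ℝ E] [FiniteDimensional ℝ E]
  [MeasurableSpace E] [BorelSpace E]

/-- The minimal norm `min {⟪x, x⟫ | x ∈ L, x ≠ 0}` of a lattice `L`. -/
def latticeMinNorm (L : Submodule ℤ E) : ℝ :=
  sInf {r : ℝ | ∃ x ∈ L, x ≠ 0 ∧ r = ⟪x, x⟫}

/-- The determinant of a lattice: the square of the Euclidean volume of a fundamental domain. -/
def latticeDet (L : Submodule ℤ E) : ℝ :=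
  ZLattice.covolume L ^ 2

/-- The Hermite invariant of a lattice `L` in a Euclidean space of dimension `n`:
the minimal norm divided by the `n`-th root of the determinant. -/
def hermiteInvariant (L : Submodule ℤ E) : ℝ :=
  latticeMinNorm L / latticeDet L ^ (1 / (Module.finrank ℝ E : ℝ))

end Hermite

namespace Graph

universe u v

variable {α : Type u} {β : Type v}

/-! ## Combinatorics of multigraphs -/

/-- A graph is connected if it has a vertex and any two vertices are joined by a path. -/
def IsConnected (G : Graph α β) : Prop :=
  V(G).Nonempty ∧ ∀ x ∈ V(G), ∀ y ∈ V(G), Relation.ReflTransGen G.Adj x y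

/-- The valence of a vertex: the number of incident edges, a loop being counted twice. -/
def valence (G : Graph α β) (x : α) : ℕ :=
  (G.incidenceSet x).ncard + (G.loopSet x).ncard

/-- The first Betti number `|E| - |V| + 1` of a finite connected graph
(for such a graph `|V| ≤ |E| + 1`, so that the subtraction does not truncate). -/
def bettiOne (G : Graph α β) : ℕ :=
  E(G).ncard + 1 - V(G).ncard

/-- `G` has a simple circuit of length `n ≥ 1`: distinct vertices `x i` and distinct edges `e i`,
indexed cyclically, with `e i` joining `x i` to `x (i + 1)`. A loop is a simple circuit of
length `1`, a pair of parallel edges is one of length `2`. -/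
def HasSimpleCircuit (G : Graph α β) (n : ℕ) : Prop :=
  0 < n ∧ ∃ (x : ZMod n → α) (e : ZMod n → β), Function.Injective x ∧ Function.Injective e ∧
    ∀ i, G.IsLink (e i) (x i) (x (i + 1))

/-- The systole of a combinatorial graph: the least length of a simple circuit. -/
def systole (G : Graph α β) : ℕ :=
  sInf {n | G.HasSimpleCircuit n}

/-- `T` is the edge set of a spanning tree of `G`: the graph with all vertices of `G` and with
edge set `T` is connected and has no simple circuit. -/
def IsSpanningTree (G : Graph α β) (T : Set β) : Prop :=
  T ⊆ E(G) ∧ (G.restrict T).IsConnected ∧ ∀ n, ¬ (G.restrict T).HasSimpleCircuit n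

/-- The complexity of a graph: the number of its spanning trees. -/
def complexity (G : Graph α β) : ℕ :=
  {T : Set β | G.IsSpanningTree T}.ncard

/-! ## Homology and the Jacobian of a weighted graph -/

/-- An orientation of each edge of `G`. -/
structure Orientation (G : Graph α β) where
  /-- the initial vertex -/
  src : E(G) → α
  /-- the terminal vertex -/
  tgt : E(G) → α
  isLink : ∀ e : E(G), G.IsLink e (src e) (tgt e)

namespace Orientation

variable {G : Graph α β} [Fintype E(G)]

/-- The boundary map from `1`-chains to `0`-chains, `∂ e = tgt e - src e`. -/
def boundary (o : G.Orientation) (R : Type*) [CommRing R] : (E(G) → R) →ₗ[R] (α →₀ R) :=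
  Fintype.linearCombination R
    (fun e => Finsupp.single (o.tgt e) (1 : R) - Finsupp.single (o.src e) (1 : R))

/-- `H₁(G, R)`, as the submodule of cycles in the module of `1`-chains. -/
def homology (o : G.Orientation) (R : Type*) [CommRing R] : Submodule R (E(G) → R) :=
  LinearMap.ker (o.boundary R)

/-- `w` is a weight function: it is nonnegative, and the symmetric bilinear form with
`⟨e, e'⟩ = w e * δ_{e e'}` on edges is positive definite on `H₁(G, ℝ)`
(the latter is automatic if all the weights are positive). -/
structure IsWeight (o : G.Orientation) (w : E(G) → ℝ) : Prop where
  nonneg : ∀ e, 0 ≤ w e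
  posDef : ∀ x ∈ o.homology ℝ, x ≠ 0 → 0 < ∑ e, w e * x e * x e

/-- The inner product `⟨x, y⟩_w = ∑ e, w e * x e * y e` on `H₁(G, ℝ)`. -/
@[reducible] def innerCore (o : G.Orientation) {w : E(G) → ℝ} (hw : o.IsWeight w) :
    InnerProductSpace.Core ℝ (o.homology ℝ) where
  inner x y := ∑ e, w e * x.1 e * y.1 e
  conj_inner_symm x y := by
    simp only [conj_trivial]
    exact Finset.sum_congr rfl fun e _ => by ring
  re_inner_nonneg x :=
    Finset.sum_nonneg fun e _ => by
      rw [mul_assoc]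
      exact mul_nonneg (hw.nonneg e) (mul_self_nonneg _)
  add_left x y z := by
    rw [← Finset.sum_add_distrib]
    exact Finset.sum_congr rfl fun e _ => by
      simp only [Submodule.coe_add, Pi.add_apply]
      ring
  smul_left x y r := by
    simp only [conj_trivial]
    rw [Finset.mul_sum]
    exact Finset.sum_congr rfl fun e _ => by
      simp only [Submodule.coe_smul, Pi.smul_apply, smul_eq_mul]
      ring
  definite x hx := by
    by_contra h
    exact (hw.posDef x.1 x.2 (fun h0 => h (Subtype.ext h0))).ne' hx

/-- The Euclidean space `(H₁(G, ℝ), ⟨·,·⟩_w)` (a copy of `H₁(G, ℝ)`, so that it does not carry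
the sup norm). -/
def JacobianSpace (o : G.Orientation) {w : E(G) → ℝ} (_hw : o.IsWeight w) : Type v :=
  o.homology ℝ

variable (o : G.Orientation) {w : E(G) → ℝ} (hw : o.IsWeight w)

instance : NormedAddCommGroup (o.JacobianSpace hw) :=
  (o.innerCore hw).toNormedAddCommGroup

instance : InnerProductSpace ℝ (o.JacobianSpace hw) :=
  InnerProductSpace.ofCore (o.innerCore hw).toCore

instance : FiniteDimensional ℝ (o.JacobianSpace hw) :=
  inferInstanceAs (FiniteDimensional ℝ (o.homology ℝ))

instance : MeasurableSpace (o.JacobianSpace hw) := borel _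

instance : BorelSpace (o.JacobianSpace hw) := ⟨rfl⟩

/-- The underlying `1`-chain of an element of `(H₁(G, ℝ), ⟨·,·⟩_w)`. -/
def toChain : o.JacobianSpace hw →ₗ[ℝ] (E(G) → ℝ) :=
  (o.homology ℝ).subtype

theorem inner_eq (x y : o.JacobianSpace hw) :
    ⟪x, y⟫ = ∑ e, w e * o.toChain hw x e * o.toChain hw y e := rfl

/-- The Jacobian `Λ(G, w)`: the lattice `H₁(G, ℤ)` in `(H₁(G, ℝ), ⟨·,·⟩_w)`. -/
def jacobian : Submodule ℤ (o.JacobianSpace hw) where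
  carrier := {x | ∃ z ∈ o.homology ℤ, ∀ e, o.toChain hw x e = (z e : ℝ)}
  zero_mem' := ⟨0, Submodule.zero_mem _, fun e => by simp⟩
  add_mem' := by
    rintro x y ⟨z, hz, hxz⟩ ⟨z', hz', hyz⟩
    exact ⟨z + z', Submodule.add_mem _ hz hz', fun e => by simp [hxz, hyz]⟩
  smul_mem' := by
    rintro n x ⟨z, hz, hxz⟩
    exact ⟨n • z, Submodule.smul_mem _ n hz, fun e => by simp [hxz]⟩

end Orientation

end Graph

end

/-! ## Cycle spaces and circuits of oriented multigraphs -/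

/-! Call two edges in series when every cycle takes equal absolute values on them. Deleting bridges
and contracting redundant members of series classes preserves the rank k of the cycle space. If no
loop turns up, what remains has minimal degree three, hence at most 2k - 2 vertices, and a
pigeonhole argument on binary branching reduced walks yields a circuit with at most 2 log₂(2k - 2) +
4 edges. Lifted back, this is a nonzero cycle with entries 0, ±1 that meets at most `circuitBound k`
series classes (`exists_cycle_of_few_classes`).

If all nonzero cycles with entries 0, ±1 have norm at least σ, one of the classes met has weight at
least σ / `circuitBound k`. Deleting an edge of that class lowers the rank by one and keeps the
hypothesis on σ. Iteration gives edges c j and cycles l j, triangular with respect to each other,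
whose successive series classes are heavy (`exists_isHeavyFlag`). The product of the b class weights
is then at least σ^b divided by the product of the bounds, and it is used twice.

For the Jacobian, the l j form a lattice basis. The component of l j orthogonal to its predecessors
still has absolute value 1 on the j-th class, so Gram–Schmidt bounds the determinant below by the
product of the class weights; σ is the minimal norm.

For the complexity, all weights are 1 and σ is the systole. The classes are disjoint, and removing
one edge from each leaves a spanning tree, so the product of the class sizes is at most the number
of spanning trees. -/

namespace OrientedMultigraph

variable {V E : Type*} {s t : E → V}

/-! ### Reduced walks -/

/-- The initial vertex of an oriented edge; `(e, true)` is `e` with its orientation reversed. -/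
def dartSrc (s t : E → V) (d : E × Bool) : V := if d.2 then t d.1 else s d.1

/-- The terminal vertex of an oriented edge. -/
def dartTgt (s t : E → V) (d : E × Bool) : V := if d.2 then s d.1 else t d.1

/-- The same edge with the opposite orientation. -/
def dartRev (d : E × Bool) : E × Bool := (d.1, !d.2)

@[simp] theorem dartSrc_dartRev (d : E × Bool) : dartSrc s t (dartRev d) = dartTgt s t d := by
  rcases d with ⟨e, _ | _⟩ <;> rfl

@[simp] theorem dartTgt_dartRev (d : E × Bool) : dartTgt s t (dartRev d) = dartSrc s t d := by
  rcases d with ⟨e, _ | _⟩ <;> rfl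

@[simp] theorem dartRev_dartRev (d : E × Bool) : dartRev (dartRev d) = d := by
  simp [dartRev]

theorem dartRev_ne (d : E × Bool) : dartRev d ≠ d := by
  rcases d with ⟨e, _ | _⟩ <;> simp [dartRev]

/-- The oriented edge `d'` may follow `d` in a reduced walk. -/
def Follows (s t : E → V) (d d' : E × Bool) : Prop :=
  dartTgt s t d = dartSrc s t d' ∧ d' ≠ dartRev d

theorem Follows.dartRev {d d' : E × Bool} (h : Follows s t d d') :
    Follows s t (dartRev d') (dartRev d) := by
  refine ⟨by simp [h.1], fun h' => h.2 ?_⟩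
  rw [h', dartRev_dartRev]

/-- The vertices `x i` and the edges `e i`, indexed cyclically, form a simple circuit. -/
structure IsCircuit (s t : E → V) {n : ℕ} (x : ZMod n → V) (e : ZMod n → E) : Prop where
  vertex_injective : Function.Injective x
  edge_injective : Function.Injective e
  link : ∀ i, (s (e i) = x i ∧ t (e i) = x (i + 1)) ∨ (t (e i) = x i ∧ s (e i) = x (i + 1))

/-- Between two visits to the same vertex lies a shorter closed walk, so induction applies unless
all initial vertices are distinct. In that case the walk itself is a circuit. Reducedness is not
required at the closing point, which is what lets segments be cut out and lets two walks with a
common first edge be glued. -/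
theorem exists_circuit_of_closed_walk (d : ℕ → E × Bool) (m : ℕ) : ∀ i : ℕ,
    (∀ n, i ≤ n → n < i + m → Follows s t (d n) (d (n + 1))) →
    dartTgt s t (d (i + m)) = dartSrc s t (d i) →
    ∃ n ≤ m, ∃ (x : ZMod (n + 1) → V) (e : ZMod (n + 1) → E), IsCircuit s t x e ∧
      ∀ j, ∃ k ≤ m, e j = (d (i + k)).1 := by
  induction m using Nat.strong_induction_on with
  | _ m ih =>
  intro i hstep hclosed
  by_cases hrep : ∃ a b, a < b ∧ b ≤ m ∧ dartSrc s t (d (i + a)) = dartSrc s t (d (i + b))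
  · obtain ⟨a, b, hab, hbm, heq⟩ := hrep
    obtain ⟨n, hn, x, e, hc, he⟩ := ih (b - a - 1) (by omega) (i + a)
      (fun n h1 h2 => hstep n (by omega) (by omega)) (by
        have := (hstep (i + a + (b - a - 1)) (by omega) (by omega)).1
        rw [show i + a + (b - a - 1) + 1 = i + b by omega] at this
        rw [this, heq])
    refine ⟨n, by omega, x, e, hc, fun j => ?_⟩
    obtain ⟨k, hk, hj⟩ := he j
    exact ⟨a + k, by omega, by rw [hj, add_assoc]⟩
  · push Not at hrep
    have hinj : ∀ a b, a ≤ m → b ≤ m → dartSrc s t (d (i + a)) = dartSrc s t (d (i + b)) →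
        a = b := by
      intro a b ha hb hab
      rcases lt_trichotomy a b with h | h | h
      · exact absurd hab (hrep a b h hb)
      · exact h
      · exact absurd hab.symm (hrep b a h ha)
    have hedge : ∀ a b, a < b → b ≤ m → (d (i + a)).1 ≠ (d (i + b)).1 := by
      intro a b hab hb h
      by_cases h2 : (d (i + a)).2 = (d (i + b)).2
      · exact hab.ne (hinj a b (by omega) hb (by rw [Prod.ext h h2]))
      -- An edge traversed again backwards starts where step `a + 1` starts, so `b = a + 1`, and the
      -- walk would backtrack.
      · have hr : d (i + b) = dartRev (d (i + a)) := by
          refine Prod.ext h.symm ?_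
          simp only [dartRev]
          revert h2
          cases (d (i + a)).2 <;> cases (d (i + b)).2 <;> simp
        have h1 := hstep (i + a) (by omega) (by omega)
        have h3 : dartSrc s t (d (i + b)) = dartSrc s t (d (i + (a + 1))) := by
          rw [hr, dartSrc_dartRev, h1.1, add_assoc]
        have h4 := hinj b (a + 1) hb (by omega) h3
        exact h1.2 (by rw [← hr, h4, add_assoc])
    have hval : ∀ j : ZMod (m + 1), ZMod.val j ≤ m := fun j => Nat.lt_succ_iff.1 (ZMod.val_lt j)
    refine ⟨m, le_rfl, fun j => dartSrc s t (d (i + j.val)), fun j => (d (i + j.val)).1,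
      ⟨fun a b hab => ZMod.val_injective _ (hinj _ _ (hval a) (hval b) hab), fun a b hab => ?_,
        fun j => ?_⟩, fun j => ⟨j.val, hval j, rfl⟩⟩
    · apply ZMod.val_injective
      rcases lt_trichotomy a.val b.val with h | h | h
      · exact absurd hab (hedge _ _ h (hval b))
      · exact h
      · exact absurd hab.symm (hedge _ _ h (hval a))
    · have key : dartTgt s t (d (i + j.val)) = dartSrc s t (d (i + (j + 1).val)) := by
        rcases (hval j).lt_or_eq with h | h
        · have h1 : (j + 1).val = j.val + 1 := by
            rw [ZMod.val_add, ZMod.val_one_eq_one_mod, Nat.add_mod_mod, Nat.mod_eq_of_lt (by omega)]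
          rw [h1, (hstep (i + j.val) (by omega) (by omega)).1, add_assoc]
        · have h1 : (j + 1).val = 0 := by
            rw [ZMod.val_add, h, ZMod.val_one_eq_one_mod, Nat.add_mod_mod, Nat.mod_self]
          rw [h1, h, hclosed, add_zero]
      rw [← key]
      rcases d (i + j.val) with ⟨e, _ | _⟩
      · exact Or.inl ⟨rfl, rfl⟩
      · exact Or.inr ⟨rfl, rfl⟩

/-! ### The cycle space -/

/-- All coordinates are `0`, `1` or `-1`. -/
def IsUnitChain (z : E → ℝ) : Prop := ∀ e, z e = 0 ∨ z e = 1 ∨ z e = -1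

/-- The real cycle space of the oriented multigraph with edges `S`, where an edge `e` runs from
`s e` to `t e`. A chain is a cycle when it pairs to zero with every coboundary. -/
def cycleSpace [Fintype E] (s t : E → V) (S : Finset E) : Submodule ℝ (E → ℝ) where
  carrier := {x | (∀ e ∉ S, x e = 0) ∧ ∀ φ : V → ℝ, ∑ e, x e * (φ (t e) - φ (s e)) = 0}
  zero_mem' := by simp
  add_mem' := by
    rintro x y ⟨hx, hx'⟩ ⟨hy, hy'⟩
    refine ⟨fun e he => by simp [hx e he, hy e he], fun φ => ?_⟩
    simp only [Pi.add_apply, add_mul, Finset.sum_add_distrib, hx' φ, hy' φ, add_zero]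
  smul_mem' := by
    rintro r x ⟨hx, hx'⟩
    refine ⟨fun e he => by simp [hx e he], fun φ => ?_⟩
    simp only [Pi.smul_apply, smul_eq_mul, mul_assoc, ← Finset.mul_sum, hx' φ, mul_zero]

variable [Fintype E] {S : Finset E}

theorem mem_cycleSpace {x : E → ℝ} : x ∈ cycleSpace s t S ↔
    (∀ e ∉ S, x e = 0) ∧ ∀ φ : V → ℝ, ∑ e, x e * (φ (t e) - φ (s e)) = 0 := Iff.rfl

theorem mem_cycleSpace_univ {x : E → ℝ} : x ∈ cycleSpace s t Finset.univ ↔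
    ∀ φ : V → ℝ, ∑ e, x e * (φ (t e) - φ (s e)) = 0 := by
  simp [mem_cycleSpace]

theorem IsCircuit.exists_cycle {n : ℕ} [NeZero n] {x : ZMod n → V} {e : ZMod n → E}
    (h : IsCircuit s t x e) (hS : ∀ i, e i ∈ S) :
    ∃ z ∈ cycleSpace s t S, IsUnitChain z ∧ (∀ i, z (e i) ≠ 0) ∧
      ∀ f, z f ≠ 0 → ∃ i, e i = f := by
  classical
  -- The sign records whether the circuit follows the orientation of the edge; pairing with a
  -- coboundary then telescopes around the circuit.
  set σ : ZMod n → ℝ := fun i => if s (e i) = x i ∧ t (e i) = x (i + 1) then 1 else -1 with hσ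
  have hσ1 : ∀ i, σ i = 1 ∨ σ i = -1 := fun i => by
    simp only [hσ]; split_ifs <;> simp
  set z : E → ℝ := fun f => ∑ i, if e i = f then σ i else 0 with hz
  have hze : ∀ i, z (e i) = σ i := fun i => by
    simp [hz, h.edge_injective.eq_iff]
  have hz0 : ∀ f, (∀ i, e i ≠ f) → z f = 0 := fun f hf => by simp [hz, hf]
  have hsupp : ∀ f, z f ≠ 0 → ∃ i, e i = f := fun f hf => by
    by_contra! hc
    exact hf (hz0 f hc)
  refine ⟨z, ⟨fun f hf => hz0 f fun i hi => hf (hi ▸ hS i), fun φ => ?_⟩, fun f => ?_,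
    fun i => ?_, hsupp⟩
  · have h1 : ∑ f, z f * (φ (t f) - φ (s f)) = ∑ i, σ i * (φ (t (e i)) - φ (s (e i))) := by
      simp only [hz, Finset.sum_mul]
      rw [Finset.sum_comm]
      refine Finset.sum_congr rfl fun i _ => ?_
      simp [ite_mul]
    have h2 : ∀ i, σ i * (φ (t (e i)) - φ (s (e i))) = φ (x (i + 1)) - φ (x i) := fun i => by
      simp only [hσ]
      split_ifs with hi
      · rw [hi.1, hi.2, one_mul]
      · obtain hl | hl := h.link i
        · exact absurd hl hi
        · rw [hl.1, hl.2]; ring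
    rw [h1, Finset.sum_congr rfl fun i _ => h2 i, Finset.sum_sub_distrib, sub_eq_zero]
    exact Fintype.sum_equiv (Equiv.addRight 1) _ _ fun i => rfl
  · by_cases hf : z f = 0
    · exact Or.inl hf
    · obtain ⟨i, rfl⟩ := hsupp f hf
      rw [hze]; exact Or.inr (hσ1 i)
  · rw [hze]
    obtain h | h := hσ1 i <;> simp [h]

/-- In the support of a cycle a reduced walk can always be continued. -/
theorem exists_follows_of_mem_support {x : E → ℝ} (hx : x ∈ cycleSpace s t S)
    (d : E × Bool) (hd : x d.1 ≠ 0) : ∃ d' : E × Bool, x d'.1 ≠ 0 ∧ Follows s t d d' := by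
  classical
  by_contra! hcon
  set v := dartTgt s t d with hv
  have hloop : dartSrc s t d ≠ v := fun h =>
    hcon d hd ⟨h.symm, (dartRev_ne d).symm⟩
  have hother : ∀ e, e ≠ d.1 → x e ≠ 0 → s e ≠ v ∧ t e ≠ v := by
    intro e he hxe
    constructor
    · intro h
      exact hcon (e, false) hxe ⟨h.symm, fun h' => he (congrArg Prod.fst h')⟩
    · intro h
      exact hcon (e, true) hxe ⟨h.symm, fun h' => he (congrArg Prod.fst h')⟩
  -- Kirchhoff's law at `v`: the edge of `d` would be the only support edge there, and it is not a
  -- loop.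
  have hsum := hx.2 (fun u => if u = v then 1 else 0)
  rw [Finset.sum_eq_single d.1] at hsum
  · rcases d with ⟨e, _ | _⟩
    · simp only [dartSrc, dartTgt] at hv hloop hsum
      simp_all
    · simp only [dartSrc, dartTgt] at hv hloop hsum
      simp_all
  · intro e _ he
    by_cases hxe : x e = 0
    · simp [hxe]
    · simp [hother e he hxe]
  · simp

/-- A reduced walk inside the finite support never gets stuck, so it eventually repeats an oriented
edge and contains a closed walk. -/
theorem exists_circuit_of_mem_cycleSpace {x : E → ℝ} (hx : x ∈ cycleSpace s t S) (hx0 : x ≠ 0) :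
    ∃ (n : ℕ) (y : ZMod (n + 1) → V) (e : ZMod (n + 1) → E), IsCircuit s t y e ∧
      ∀ j, x (e j) ≠ 0 := by
  obtain ⟨e₀, he₀⟩ := Function.ne_iff.1 hx0
  choose next hnext hfol using fun d : {d : E × Bool // x d.1 ≠ 0} =>
    exists_follows_of_mem_support hx d.1 d.2
  let nxt : {d : E × Bool // x d.1 ≠ 0} → {d : E × Bool // x d.1 ≠ 0} :=
    fun d => ⟨next d, hnext d⟩
  let w : ℕ → {d : E × Bool // x d.1 ≠ 0} := fun n => nxt^[n] ⟨(e₀, false), he₀⟩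
  have hw : ∀ n, Follows s t (w n).1 (w (n + 1)).1 := fun n => by
    have : w (n + 1) = nxt (w n) := Function.iterate_succ_apply' _ _ _
    rw [this]
    exact hfol (w n)
  obtain ⟨i, j, hij, heq⟩ := Finite.exists_ne_map_eq_of_infinite w
  wlog hlt : i < j generalizing i j
  · exact this j i hij.symm heq.symm (by omega)
  obtain ⟨n, -, y, e, hc, he⟩ := exists_circuit_of_closed_walk (s := s) (t := t)
    (fun n => (w n).1) (j - i - 1) i (fun n _ _ => hw n) (by
      have := (hw (i + (j - i - 1))).1
      rw [show i + (j - i - 1) + 1 = j by omega, ← heq] at this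
      exact this)
  refine ⟨n, y, e, hc, fun k => ?_⟩
  obtain ⟨l, -, hl⟩ := he k
  rw [hl]
  exact (w (i + l)).2

end OrientedMultigraph

namespace OrientedMultigraph

variable {V E : Type*} {s t : E → V} {S : Finset E}

/-! ### The rank of the cycle space -/

section Rank

variable [Fintype E] [DecidableEq E]

open scoped Classical in
/-- The transposed incidence matrix on the vertices in `U`, with an extra column for every edge
outside `S`. -/
noncomputable def coboundaryMatrix (s t : E → V) (S : Finset E) (U : Finset V) :
    Matrix E (U ⊕ {e // e ∉ S}) ℝ :=
  fun e => Sum.elim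
    (fun v => if e ∈ S then (if t e = v then 1 else 0) - (if s e = v then 1 else 0) else 0)
    (fun e' => if e = e' then 1 else 0)

theorem coboundaryMatrix_mulVec_of_mem {U : Finset V} (f : U ⊕ {e // e ∉ S} → ℝ) {e : E}
    (he : e ∈ S) (hs : s e ∈ U) (ht : t e ∈ U) :
    (coboundaryMatrix s t S U).mulVec f e = f (.inl ⟨t e, ht⟩) - f (.inl ⟨s e, hs⟩) := by
  classical
  have h1 : ∀ e' : {e // e ∉ S}, ¬ e = e' := fun e' h => e'.2 (h ▸ he)
  have h2 : ∀ (u : V) (hu : u ∈ U) (v : U), (u = v) ↔ (v = ⟨u, hu⟩) := fun u hu v =>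
    ⟨fun h => Subtype.ext h.symm, fun h => by rw [h]⟩
  simp only [Matrix.mulVec, dotProduct, coboundaryMatrix, Fintype.sum_sum_type, Sum.elim_inl,
    Sum.elim_inr, he, if_true, h1, if_false, zero_mul, Finset.sum_const_zero, add_zero, sub_mul,
    Finset.sum_sub_distrib, ite_mul, one_mul]
  simp only [h2 _ ht, h2 _ hs, Finset.sum_ite_eq', Finset.mem_univ, if_true]

theorem coboundaryMatrix_mulVec_of_notMem {U : Finset V} (f : U ⊕ {e // e ∉ S} → ℝ) {e : E}
    (he : e ∉ S) : (coboundaryMatrix s t S U).mulVec f e = f (.inr ⟨e, he⟩) := by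
  classical
  have h2 : ∀ v : {e // e ∉ S}, (e = v) ↔ (v = ⟨e, he⟩) := fun v =>
    ⟨fun h => Subtype.ext h.symm, fun h => by rw [h]⟩
  simp only [Matrix.mulVec, dotProduct, coboundaryMatrix, Fintype.sum_sum_type, Sum.elim_inl,
    Sum.elim_inr, he, if_false, zero_mul, Finset.sum_const_zero, zero_add, ite_mul, one_mul]
  simp only [h2, Finset.sum_ite_eq', Finset.mem_univ, if_true]

/-- The incidence columns impose Kirchhoff's law at the vertices; the extra columns force the chain
to vanish off `S`. -/
theorem cycleSpace_eq_ker {U : Finset V} (hU : ∀ e ∈ S, s e ∈ U ∧ t e ∈ U) :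
    cycleSpace s t S = LinearMap.ker (coboundaryMatrix s t S U).transpose.mulVecLin := by
  classical
  have key : ∀ (x : E → ℝ) (f : U ⊕ {e // e ∉ S} → ℝ),
      (∑ e, x e * (coboundaryMatrix s t S U).mulVec f e) =
        ∑ i, (coboundaryMatrix s t S U).transpose.mulVec x i * f i := by
    intro x f
    have := Matrix.dotProduct_mulVec x (coboundaryMatrix s t S U) f
    rw [← Matrix.mulVec_transpose] at this
    exact this
  ext x
  rw [LinearMap.mem_ker, Matrix.mulVecLin_apply]
  constructor
  · rintro ⟨h0, hx⟩
    have hall : ∀ f : U ⊕ {e // e ∉ S} → ℝ, ∑ i, (coboundaryMatrix s t S U).transpose.mulVec x i * f i = 0 := by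
      intro f
      rw [← key, ← hx (fun v => if h : v ∈ U then f (.inl ⟨v, h⟩) else 0)]
      refine Finset.sum_congr rfl fun e _ => ?_
      by_cases he : e ∈ S
      · rw [coboundaryMatrix_mulVec_of_mem f he (hU e he).1 (hU e he).2, dif_pos, dif_pos]
      · rw [h0 e he, zero_mul, zero_mul]
    ext i
    have := hall (Pi.single i 1)
    simpa [Pi.single_apply] using this
  · intro hx
    have hall : ∀ f, ∑ e, x e * (coboundaryMatrix s t S U).mulVec f e = 0 := fun f => by
      rw [key, hx]; simp
    have h0 : ∀ e ∉ S, x e = 0 := by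
      intro e he
      have := congrFun hx (.inr ⟨e, he⟩)
      simpa [Matrix.mulVec, dotProduct, coboundaryMatrix, Matrix.transpose_apply] using this
    refine ⟨h0, fun φ => ?_⟩
    rw [← hall (Sum.elim (fun v => φ v) 0)]
    refine Finset.sum_congr rfl fun e _ => ?_
    by_cases he : e ∈ S
    · rw [coboundaryMatrix_mulVec_of_mem _ he (hU e he).1 (hU e he).2]; rfl
    · rw [h0 e he, zero_mul, zero_mul]

/-- Row rank equals column rank. The kernel on the right consists of the potentials on `U` that are
constant along the edges of `S`, so its dimension counts connected components. -/
theorem finrank_cycleSpace_add_card {U : Finset V} (hU : ∀ e ∈ S, s e ∈ U ∧ t e ∈ U) :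
    Module.finrank ℝ (cycleSpace s t S) + U.card =
      S.card + Module.finrank ℝ (LinearMap.ker (coboundaryMatrix s t S U).mulVecLin) := by
  classical
  have h1 := LinearMap.finrank_range_add_finrank_ker
    (coboundaryMatrix s t S U).transpose.mulVecLin
  have h2 := LinearMap.finrank_range_add_finrank_ker (coboundaryMatrix s t S U).mulVecLin
  have h3 := Matrix.rank_transpose (coboundaryMatrix s t S U)
  rw [Matrix.rank, Matrix.rank] at h3
  rw [← cycleSpace_eq_ker hU, Module.finrank_fintype_fun_eq_card] at h1
  rw [Module.finrank_fintype_fun_eq_card, Fintype.card_sum, Fintype.card_coe,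
    Fintype.card_subtype_compl, Fintype.card_coe] at h2
  have := S.card_le_univ
  omega

theorem card_add_one_le_finrank_cycleSpace_add_card {U : Finset V}
    (hU : ∀ e ∈ S, s e ∈ U ∧ t e ∈ U) (hne : U.Nonempty) :
    S.card + 1 ≤ Module.finrank ℝ (cycleSpace s t S) + U.card := by
  classical
  rw [finrank_cycleSpace_add_card hU]
  obtain ⟨u, hu⟩ := hne
  refine Nat.add_le_add_left ?_ _
  rw [Nat.one_le_iff_ne_zero, ← Nat.pos_iff_ne_zero, Module.finrank_pos_iff_exists_ne_zero]
  refine ⟨⟨Sum.elim 1 0, ?_⟩, fun h => ?_⟩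
  · rw [LinearMap.mem_ker, Matrix.mulVecLin_apply]
    ext e
    by_cases he : e ∈ S
    · rw [coboundaryMatrix_mulVec_of_mem _ he (hU e he).1 (hU e he).2]; simp
    · rw [coboundaryMatrix_mulVec_of_notMem _ he]; simp
  · have := congrFun (congrArg Subtype.val h) (.inl ⟨u, hu⟩)
    simp at this

/-- A potential that is constant along edges is determined by one value, when the graph is
connected. -/
theorem finrank_cycleSpace_univ_add_card {U : Finset V} (hU : ∀ e, s e ∈ U ∧ t e ∈ U)
    (hne : U.Nonempty)
    (hconn : ∀ u ∈ U, ∀ v ∈ U,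
      Relation.ReflTransGen (fun a b => ∃ e, (s e = a ∧ t e = b) ∨ (s e = b ∧ t e = a)) u v) :
    Module.finrank ℝ (cycleSpace s t Finset.univ) + U.card = Fintype.card E + 1 := by
  classical
  have hU' : ∀ e ∈ Finset.univ, s e ∈ U ∧ t e ∈ U := fun e _ => hU e
  refine le_antisymm ?_ (card_add_one_le_finrank_cycleSpace_add_card hU' hne)
  rw [finrank_cycleSpace_add_card hU', Finset.card_univ]
  refine Nat.add_le_add_left ?_ _
  obtain ⟨u, hu⟩ := hne
  set K := LinearMap.ker (coboundaryMatrix s t Finset.univ U).mulVecLin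
  have hinj : Function.Injective
      ((LinearMap.proj (R := ℝ) (φ := fun _ => ℝ) (.inl ⟨u, hu⟩)).comp K.subtype : K →ₗ[ℝ] ℝ) := by
    rw [← LinearMap.ker_eq_bot, LinearMap.ker_eq_bot']
    rintro ⟨f, hf⟩ hfu
    have hfu : f (.inl ⟨u, hu⟩) = 0 := hfu
    have hedge : ∀ e, f (.inl ⟨t e, (hU e).2⟩) = f (.inl ⟨s e, (hU e).1⟩) := fun e => by
      have := congrFun (LinearMap.mem_ker.1 hf) e
      rw [Matrix.mulVecLin_apply, coboundaryMatrix_mulVec_of_mem f (Finset.mem_univ e) (hU e).1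
        (hU e).2] at this
      exact sub_eq_zero.1 this
    have hall : ∀ v, Relation.ReflTransGen
        (fun a b => ∃ e, (s e = a ∧ t e = b) ∨ (s e = b ∧ t e = a)) u v →
        ∀ hv : v ∈ U, f (.inl ⟨v, hv⟩) = 0 := by
      intro v hv
      induction hv with
      | refl => exact fun _ => hfu
      | tail _ hbc ih =>
        obtain ⟨e, ⟨rfl, rfl⟩ | ⟨rfl, rfl⟩⟩ := hbc
        · intro hc
          rw [hedge e]; exact ih _
        · intro hc
          rw [← hedge e]; exact ih _
    ext i
    rcases i with v | e
    · exact hall v.1 (hconn u hu v.1 v.2) v.2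
    · exact absurd (Finset.mem_univ _) e.2
  simpa using LinearMap.finrank_le_finrank_of_injective hinj

end Rank

/-! ### Short circuits in graphs of minimal degree three -/

/-- Kirchhoff's law at `v`: if only one other edge f met `v`, then ±x e ± x f = 0 for every cycle
and the two would be in series; with no other edge, `e` would be a bridge. -/
theorem exists_two_other_edges [Fintype E] (hloop : ∀ e ∈ S, s e ≠ t e)
    (hbridge : ∀ e ∈ S, ∃ x ∈ cycleSpace s t S, x e ≠ 0)
    (hseries : ∀ e ∈ S, ∀ f ∈ S, e ≠ f → ∃ x ∈ cycleSpace s t S, |x e| ≠ |x f|)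
    {e : E} (he : e ∈ S) {v : V} (hev : s e = v ∨ t e = v) :
    ∃ f ∈ S, ∃ g ∈ S, f ≠ g ∧ f ≠ e ∧ g ≠ e ∧ (s f = v ∨ t f = v) ∧ (s g = v ∨ t g = v) := by
  classical
  have habs : ∀ f ∈ S, (s f = v ∨ t f = v) → ∀ r : ℝ,
      |r * ((if t f = v then 1 else 0) - (if s f = v then 1 else 0))| = |r| := by
    intro f hf hfv r
    rcases hfv with h | h
    · have : t f ≠ v := fun h' => hloop f hf (h.trans h'.symm)
      simp [h, this]
    · have : s f ≠ v := fun h' => hloop f hf (h'.trans h.symm)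
      simp [h, this]
  have hzero : ∀ x ∈ cycleSpace s t S, ∀ f, ¬ (f ∈ S ∧ (s f = v ∨ t f = v)) →
      x f * ((if t f = v then 1 else 0) - (if s f = v then 1 else 0)) = 0 := by
    intro x hx f hf
    by_cases hfS : f ∈ S
    · have : ¬ (s f = v ∨ t f = v) := fun h => hf ⟨hfS, h⟩
      push Not at this
      simp [this]
    · simp [hx.1 f hfS]
  by_contra! hcon
  obtain ⟨f, hf⟩ | hno : (∃ f, f ∈ S ∧ f ≠ e ∧ (s f = v ∨ t f = v)) ∨
      ¬ ∃ f, f ∈ S ∧ f ≠ e ∧ (s f = v ∨ t f = v) := em _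
  · obtain ⟨hfS, hfe, hfv⟩ := hf
    obtain ⟨x, hx, hne⟩ := hseries e he f hfS hfe.symm
    have hsum := hx.2 (fun u => if u = v then 1 else 0)
    rw [Finset.sum_eq_add_of_mem e f (Finset.mem_univ _) (Finset.mem_univ _) hfe.symm] at hsum
    · apply hne
      rw [← habs e he hev (x e), ← habs f hfS hfv (x f), eq_neg_of_add_eq_zero_left hsum, abs_neg]
    · rintro g - ⟨hge, hgf⟩
      refine hzero x hx g fun hg => ?_
      have := hcon f hfS g hg.1 hgf.symm hfe hge hfv
      rcases hg.2 with h | h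
      · exact this.1 h
      · exact this.2 h
  · obtain ⟨x, hx, hne⟩ := hbridge e he
    have hsum := hx.2 (fun u => if u = v then 1 else 0)
    rw [Finset.sum_eq_single e] at hsum
    · have := habs e he hev (x e)
      rw [hsum, abs_zero] at this
      exact hne (abs_eq_zero.1 this.symm)
    · intro g _ hge
      exact hzero x hx g fun hg => hno ⟨g, hg.1, hge, hg.2⟩
    · simp

/-- The last oriented edge of the walk that starts with `d₀` and makes the choices given by a
binary word, read from right to left. -/
def walkEnd {D : Type*} (next : D → Bool → D) (d₀ : D) (w : List Bool) : D :=
  w.foldr (fun b d => next d b) d₀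

theorem follows_walkEnd_drop {D : Type*} (p : D → E × Bool) {next : D → Bool → D}
    (hnext : ∀ d b, Follows s t (p d) (p (next d b))) (d₀ : D) (w : List Bool) {i : ℕ}
    (hi : i < w.length) :
    Follows s t (p (walkEnd next d₀ (w.drop (i + 1)))) (p (walkEnd next d₀ (w.drop i))) := by
  rw [List.drop_eq_getElem_cons hi]
  exact hnext _ _

/-- Go out along `w` and return along `w'`. The two walks have `w.length + 1` oriented edges each,
since both begin with that of `d₀`. Distinct last oriented edges prevent backtracking at the turning
point; the backtracking over `d₀` occurs only at the closing point, where it is allowed. -/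
theorem exists_circuit_of_walkEnd_ne {D : Type*} (p : D → E × Bool) {next : D → Bool → D}
    (hnext : ∀ d b, Follows s t (p d) (p (next d b))) (d₀ : D) (w w' : List Bool)
    (hlen : w'.length = w.length)
    (htgt : dartTgt s t (p (walkEnd next d₀ w)) = dartTgt s t (p (walkEnd next d₀ w')))
    (hne : p (walkEnd next d₀ w) ≠ p (walkEnd next d₀ w')) :
    ∃ n ≤ 2 * w.length + 1, ∃ (x : ZMod (n + 1) → V) (e : ZMod (n + 1) → E),
      IsCircuit s t x e ∧ ∀ j, ∃ u, e j = (p (walkEnd next d₀ u)).1 := by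
  set L := w.length with hL
  let d : ℕ → E × Bool := fun i => if i ≤ L then p (walkEnd next d₀ (w.drop (L - i)))
    else dartRev (p (walkEnd next d₀ (w'.drop (i - L - 1))))
  have hd : ∀ i, ∃ u, (d i).1 = (p (walkEnd next d₀ u)).1 := fun i => by
    simp only [d]
    split_ifs
    · exact ⟨_, rfl⟩
    · exact ⟨_, rfl⟩
  obtain ⟨n, hn, x, e, hc, he⟩ := exists_circuit_of_closed_walk (s := s) (t := t) d (2 * L + 1) 0
    (fun i _ hi => by
      rcases lt_trichotomy i L with h | h | h
      · simp only [d, h.le, if_true, Nat.succ_le_of_lt h]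
        have := follows_walkEnd_drop p hnext d₀ w (i := L - (i + 1)) (by omega)
        rwa [show L - (i + 1) + 1 = L - i by omega] at this
      · have h1 : ¬ i + 1 ≤ L := by omega
        simp only [d, h.le, if_true, h1, if_false]
        rw [show L - i = 0 by omega, show i + 1 - L - 1 = 0 by omega, List.drop_zero,
          List.drop_zero]
        refine ⟨by rw [dartSrc_dartRev, htgt], fun h => hne ?_⟩
        rw [← dartRev_dartRev (p (walkEnd next d₀ w)), ← h, dartRev_dartRev]
      · have h1 : ¬ i + 1 ≤ L := by omega
        simp only [d, h.not_ge, if_false, h1]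
        have := follows_walkEnd_drop p hnext d₀ w' (i := i - L - 1) (by omega)
        rw [show i - L - 1 + 1 = i + 1 - L - 1 by omega] at this
        exact this.dartRev)
    (by
      have h1 : ¬ 0 + (2 * L + 1) ≤ L := by omega
      simp only [d, h1, if_false, Nat.zero_le, if_true]
      rw [dartTgt_dartRev, List.drop_of_length_le (by omega), List.drop_of_length_le (by omega)])
  refine ⟨n, hn, x, e, hc, fun j => ?_⟩
  obtain ⟨k, -, hk⟩ := he j
  rw [hk]
  exact hd _

theorem exists_short_circuit_of_branching (U : Finset V)
    (hU : ∀ e ∈ S, s e ∈ U ∧ t e ∈ U) (hS : S.Nonempty)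
    (hbranch : ∀ e ∈ S, ∀ v, (s e = v ∨ t e = v) →
      ∃ f ∈ S, ∃ g ∈ S, f ≠ g ∧ f ≠ e ∧ g ≠ e ∧ (s f = v ∨ t f = v) ∧ (s g = v ∨ t g = v))
    {r : ℕ} (hr : U.card < 2 ^ r) :
    ∃ n ≤ 2 * r + 1, ∃ (x : ZMod (n + 1) → V) (e : ZMod (n + 1) → E),
      IsCircuit s t x e ∧ ∀ j, e j ∈ S := by
  classical
  have hdart : ∀ f v, (s f = v ∨ t f = v) → ∃ d : E × Bool, d.1 = f ∧ dartSrc s t d = v := by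
    rintro f v (h | h)
    · exact ⟨(f, false), rfl, h⟩
    · exact ⟨(f, true), rfl, h⟩
  have htgt : ∀ d : E × Bool, s d.1 = dartTgt s t d ∨ t d.1 = dartTgt s t d := by
    rintro ⟨e, _ | _⟩ <;> simp [dartTgt]
  have hex : ∀ d : {d : E × Bool // d.1 ∈ S}, ∃ n : Bool → {d : E × Bool // d.1 ∈ S},
      Function.Injective n ∧ ∀ b, Follows s t d.1 (n b).1 := by
    rintro ⟨d, hd⟩
    obtain ⟨f, hf, g, hg, hfg, hfe, hge, hfv, hgv⟩ := hbranch d.1 hd (dartTgt s t d) (htgt d)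
    obtain ⟨d₁, rfl, h₁⟩ := hdart f _ hfv
    obtain ⟨d₂, rfl, h₂⟩ := hdart g _ hgv
    refine ⟨fun b => if b then ⟨d₁, hf⟩ else ⟨d₂, hg⟩, ?_, ?_⟩
    · have h12 : d₁ ≠ d₂ := fun h => hfg (by rw [h])
      rintro (_ | _) (_ | _) h
      · rfl
      · exact absurd (congrArg Subtype.val h).symm h12
      · exact absurd (congrArg Subtype.val h) h12
      · rfl
    · rintro (_ | _)
      · exact ⟨h₂.symm, fun h => hge (by have h' : d₂ = dartRev d := h; rw [h']; rfl)⟩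
      · exact ⟨h₁.symm, fun h => hfe (by have h' : d₁ = dartRev d := h; rw [h']; rfl)⟩
  choose nx hinj hfol using hex
  obtain ⟨e₀, he₀⟩ := hS
  let d₀ : {d : E × Bool // d.1 ∈ S} := ⟨(e₀, false), he₀⟩
  by_contra! hcon
  -- Without a short circuit, words of equal length are determined by the endpoints of their walks:
  -- the last oriented edges must agree, hence so do the last choices and, by induction, the earlier
  -- ones. Then 2 ^ r words need as many vertices.
  have hunique : ∀ w w' : List Bool, w'.length = w.length → w.length ≤ r →
      dartTgt s t (walkEnd nx d₀ w).1 = dartTgt s t (walkEnd nx d₀ w').1 → w = w' := by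
    intro w
    induction w with
    | nil => intro w' h _ _; exact (List.length_eq_zero_iff.1 h).symm
    | cons b w ih =>
      intro w' hlen hr' ht
      obtain _ | ⟨b', w'⟩ := w'
      · simp at hlen
      by_cases hne : walkEnd nx d₀ (b :: w) = walkEnd nx d₀ (b' :: w')
      · have h1 := (hfol (walkEnd nx d₀ w) b).1
        have h2 := (hfol (walkEnd nx d₀ w') b').1
        have hne' : nx (walkEnd nx d₀ w) b = nx (walkEnd nx d₀ w') b' := hne
        rw [hne', ← h2] at h1
        have hw := ih w' (by simpa using hlen) (by simp at hr'; omega) h1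
        subst hw
        rw [hinj _ hne']
      · obtain ⟨n, hn, x, e, hc, he⟩ := exists_circuit_of_walkEnd_ne Subtype.val hfol d₀ _ _ hlen ht
          (fun h => hne (Subtype.ext h))
        obtain ⟨j, hj⟩ := hcon n (by omega) x e hc
        obtain ⟨u, hu⟩ := he j
        exact absurd (hu ▸ (walkEnd nx d₀ u).2) hj
  have htU : ∀ d : {d : E × Bool // d.1 ∈ S}, dartTgt s t d.1 ∈ U := fun d => by
    rcases htgt d.1 with h | h
    · rw [← h]; exact (hU _ d.2).1
    · rw [← h]; exact (hU _ d.2).2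
  obtain ⟨w, w', hne, heq⟩ := Fintype.exists_ne_map_eq_of_card_lt
    (fun w : List.Vector Bool r => (⟨_, htU (walkEnd nx d₀ w.toList)⟩ : U)) (by
      rw [Fintype.card_coe, card_vector, Fintype.card_bool]; exact hr)
  exact hne (List.Vector.eq _ _ (hunique _ _ (by simp) (by simp) (congrArg Subtype.val heq)))

end OrientedMultigraph

namespace OrientedMultigraph

variable {V E : Type*} [Fintype E] [DecidableEq E]

/-! ### Cycles meeting few series classes -/

/-! ### Contraction of an edge -/

section Contraction

variable [DecidableEq V] {s t : E → V} {S : Finset E} {f : E}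

/-- The vertex map that contracts the edge `f`. -/
def contractVertex (s t : E → V) (f : E) (v : V) : V := if v = t f then s f else v

theorem update_mem_cycleSpace_contract {x : E → ℝ} (hx : x ∈ cycleSpace s t S) :
    Function.update x f 0 ∈
      cycleSpace (contractVertex s t f ∘ s) (contractVertex s t f ∘ t) (S.erase f) := by
  refine ⟨fun e he => ?_, fun φ => ?_⟩
  · by_cases hef : e = f
    · simp [hef]
    · rw [Function.update_of_ne hef]
      exact hx.1 e fun h => he (Finset.mem_erase.2 ⟨hef, h⟩)
  · rw [← hx.2 (φ ∘ contractVertex s t f)]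
    refine Finset.sum_congr rfl fun e _ => ?_
    by_cases hef : e = f
    · subst hef
      by_cases h : s e = t e <;> simp [contractVertex]
    · simp [Function.update_of_ne hef]

theorem exists_update_eq_of_mem_cycleSpace_contract (hf : f ∈ S) {y : E → ℝ}
    (hy : y ∈ cycleSpace (contractVertex s t f ∘ s) (contractVertex s t f ∘ t) (S.erase f)) :
    ∃ x ∈ cycleSpace s t S, Function.update x f 0 = y := by
  have hyf : y f = 0 := hy.1 f (by simp)
  set δ : V → ℝ := fun v => if v = t f then 1 else 0 with hδ
  -- The value on `f` is the one that balances the flow at `t f`; contraction only guarantees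
  -- balance at the merged vertex.
  set r : ℝ := -∑ e, y e * (δ (t e) - δ (s e)) with hr
  refine ⟨Function.update y f r, ⟨fun e he => ?_, fun φ => ?_⟩, ?_⟩
  · have hef : e ≠ f := fun h => he (h ▸ hf)
    rw [Function.update_of_ne hef]
    exact hy.1 e fun h => he (Finset.mem_of_mem_erase h)
  · have h1 : ∑ e, Function.update y f r e * (φ (t e) - φ (s e)) =
        ∑ e, y e * (φ (t e) - φ (s e)) + r * (φ (t f) - φ (s f)) := by
      rw [← Finset.add_sum_erase _ _ (Finset.mem_univ f), Function.update_self,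
        ← Finset.add_sum_erase _ (fun e => y e * (φ (t e) - φ (s e))) (Finset.mem_univ f), hyf,
        zero_mul, zero_add, add_comm]
      congr 1
      exact Finset.sum_congr rfl fun e he => by
        rw [Function.update_of_ne (Finset.ne_of_mem_erase he)]
    have h2 : ∀ v, φ v = φ (contractVertex s t f v) + (φ (t f) - φ (s f)) * δ v := by
      intro v
      by_cases hv : v = t f <;> simp [contractVertex, hδ, hv]
    have h3 : ∑ e, y e * (φ (t e) - φ (s e)) =
        (φ (t f) - φ (s f)) * ∑ e, y e * (δ (t e) - δ (s e)) := by
      have := hy.2 φ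
      simp only [Function.comp] at this
      rw [← zero_add ((φ (t f) - φ (s f)) * _), ← this, Finset.mul_sum, ← Finset.sum_add_distrib]
      refine Finset.sum_congr rfl fun e _ => ?_
      rw [h2 (t e), h2 (s e)]
      ring
    rw [h1, h3, hr]
    ring
  · rw [Function.update_idem, ← hyf, Function.update_eq_self]

theorem update_injOn_cycleSpace (hloop : s f ≠ t f) {x y : E → ℝ}
    (hx : x ∈ cycleSpace s t S) (hy : y ∈ cycleSpace s t S)
    (hxy : Function.update x f 0 = Function.update y f 0) : x = y := by
  have hne : ∀ e, e ≠ f → (x - y) e = 0 := fun e he => by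
    have := congrFun hxy e
    rw [Function.update_of_ne he, Function.update_of_ne he] at this
    simp [this]
  have hsum := ((cycleSpace s t S).sub_mem hx hy).2 (fun v => if v = t f then 1 else 0)
  rw [Finset.sum_eq_single f (fun e _ he => by rw [hne e he, zero_mul]) (by simp)] at hsum
  have hf0 : (x - y) f = 0 := by simpa [hloop] using hsum
  rw [← sub_eq_zero]
  ext e
  by_cases he : e = f
  · rw [he, hf0]; rfl
  · rw [hne e he]; rfl

theorem finrank_cycleSpace_contract (hf : f ∈ S) (hloop : s f ≠ t f) :
    Module.finrank ℝ
      (cycleSpace (contractVertex s t f ∘ s) (contractVertex s t f ∘ t) (S.erase f)) =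
      Module.finrank ℝ (cycleSpace s t S) := by
  let R : cycleSpace s t S →ₗ[ℝ]
      cycleSpace (contractVertex s t f ∘ s) (contractVertex s t f ∘ t) (S.erase f) :=
    { toFun := fun x => ⟨Function.update x.1 f 0, update_mem_cycleSpace_contract x.2⟩
      map_add' := fun x y => Subtype.ext (by
        ext e
        by_cases he : e = f <;> simp [he])
      map_smul' := fun r x => Subtype.ext (by
        ext e
        by_cases he : e = f <;> simp [he]) }
  refine (LinearEquiv.ofBijective R ⟨fun x y h => ?_, fun y => ?_⟩).finrank_eq.symm
  · exact Subtype.ext (update_injOn_cycleSpace hloop x.2 y.2 (congrArg Subtype.val h))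
  · obtain ⟨x, hx, h⟩ := exists_update_eq_of_mem_cycleSpace_contract hf y.2
    exact ⟨⟨x, hx⟩, Subtype.ext h⟩

end Contraction

/-! ### Deletion, loops and the reduction to minimal degree three -/

theorem mem_cycleSpace_erase {s t : E → V} {S : Finset E} {f : E} {x : E → ℝ} :
    x ∈ cycleSpace s t (S.erase f) ↔ x ∈ cycleSpace s t S ∧ x f = 0 := by
  constructor
  · rintro ⟨h1, h2⟩
    exact ⟨⟨fun e he => h1 e fun h => he (Finset.mem_of_mem_erase h), h2⟩, h1 f (by simp)⟩
  · rintro ⟨⟨h1, h2⟩, h3⟩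
    refine ⟨fun e he => ?_, h2⟩
    by_cases hef : e = f
    · rw [hef, h3]
    · exact h1 e fun h => he (Finset.mem_erase.2 ⟨hef, h⟩)

theorem single_mem_cycleSpace {s t : E → V} {S : Finset E} {f : E} (hf : f ∈ S)
    (hloop : s f = t f) : Pi.single f 1 ∈ cycleSpace s t S := by
  refine ⟨fun e he => Pi.single_eq_of_ne (fun h : e = f => he (h ▸ hf)) _, fun φ => ?_⟩
  rw [Finset.sum_eq_single f (fun e _ he => by rw [Pi.single_eq_of_ne he, zero_mul]) (by simp),
    hloop, sub_self, mul_zero]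

omit [Fintype E] in
theorem isUnitChain_single (f : E) : IsUnitChain (Pi.single f (1 : ℝ) : E → ℝ) := by
  intro e
  by_cases h : e = f
  · subst h; simp
  · simp [h]

/-- A bound for the number of series classes met by a shortest circuit in a graph with first
Betti number `k`. -/
def circuitBound (k : ℕ) : ℕ := 2 * Nat.log 2 (2 * k - 2) + 4

theorem exists_short_circuit_of_reduced {s t : E → V} {S : Finset E}
    (hpos : 0 < Module.finrank ℝ (cycleSpace s t S)) (hloop : ∀ e ∈ S, s e ≠ t e)
    (hbridge : ∀ e ∈ S, ∃ x ∈ cycleSpace s t S, x e ≠ 0)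
    (hseries : ∀ e ∈ S, ∀ f ∈ S, e ≠ f → ∃ x ∈ cycleSpace s t S, |x e| ≠ |x f|) :
    ∃ n, n + 1 ≤ circuitBound (Module.finrank ℝ (cycleSpace s t S)) ∧
      ∃ (x : ZMod (n + 1) → V) (e : ZMod (n + 1) → E), IsCircuit s t x e ∧ ∀ j, e j ∈ S := by
  classical
  have hS : S.Nonempty := by
    obtain ⟨x, hx⟩ := Module.finrank_pos_iff_exists_ne_zero.1 hpos
    by_contra hne
    rw [Finset.not_nonempty_iff_eq_empty] at hne
    exact hx (Subtype.ext (funext fun e => x.2.1 e (by simp [hne])))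
  set k := Module.finrank ℝ (cycleSpace s t S) with hk
  set U := S.image s ∪ S.image t with hUdef
  have hU : ∀ e ∈ S, s e ∈ U ∧ t e ∈ U := fun e he =>
    ⟨Finset.mem_union_left _ (Finset.mem_image_of_mem _ he),
      Finset.mem_union_right _ (Finset.mem_image_of_mem _ he)⟩
  have hUne : U.Nonempty := hS.elim fun e he => ⟨_, (hU e he).1⟩
  have hdeg := fun e he v hev => exists_two_other_edges hloop hbridge hseries (e := e) he (v := v) hev
  have h1 := card_add_one_le_finrank_cycleSpace_add_card hU hUne
  -- Double counting of incidences; together with `h1` it gives at most 2k - 2 vertices.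
  have h2 : U.card * 3 ≤ S.card * 2 := by
    refine Finset.card_mul_le_card_mul (fun v e => s e = v ∨ t e = v) (fun v hv => ?_)
      fun e he => ?_
    · obtain ⟨e, he, hev⟩ : ∃ e ∈ S, s e = v ∨ t e = v := by
        rcases Finset.mem_union.1 hv with h | h
        · obtain ⟨e, he, h⟩ := Finset.mem_image.1 h
          exact ⟨e, he, Or.inl h⟩
        · obtain ⟨e, he, h⟩ := Finset.mem_image.1 h
          exact ⟨e, he, Or.inr h⟩
      obtain ⟨f, hf, g, hg, hfg, hfe, hge, hfv, hgv⟩ := hdeg e he v hev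
      refine (Finset.card_eq_three.2 ⟨e, f, g, hfe.symm, hge.symm, hfg, rfl⟩).symm.le.trans
        (Finset.card_le_card ?_)
      intro a ha
      simp only [Finset.mem_insert, Finset.mem_singleton] at ha
      rw [Finset.mem_bipartiteAbove]
      rcases ha with rfl | rfl | rfl <;> constructor <;> assumption
    · refine (Finset.card_le_card (t := {s e, t e}) fun v hv => ?_).trans Finset.card_le_two
      have := ((Finset.mem_bipartiteBelow _).1 hv).2
      simp only [Finset.mem_insert, Finset.mem_singleton]
      exact this.imp Eq.symm Eq.symm
  obtain ⟨n, hn, x, e, hc, he⟩ := exists_short_circuit_of_branching U hU hS hdeg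
    (r := Nat.log 2 (2 * k - 2) + 1)
    (lt_of_le_of_lt (by omega) (Nat.lt_pow_succ_log_self one_lt_two (2 * k - 2)))
  exact ⟨n, by unfold circuitBound; omega, x, e, hc, he⟩

/-- Induction on the number of edges. A loop is a cycle of one class, a bridge is deleted, and one
edge of a series pair is contracted; these last two moves keep the rank and the series relations. In
the remaining case a short circuit exists, and its edges serve as `A`. -/
theorem exists_cycle_of_few_classes (m : ℕ) : ∀ (s t : E → V) (S : Finset E), S.card = m →
    0 < Module.finrank ℝ (cycleSpace s t S) →
    ∃ z ∈ cycleSpace s t S, z ≠ 0 ∧ IsUnitChain z ∧ ∃ A : Finset E,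
      A.card ≤ circuitBound (Module.finrank ℝ (cycleSpace s t S)) ∧
      ∀ e, z e ≠ 0 → ∃ a ∈ A, ∀ x ∈ cycleSpace s t S, |x e| = |x a| := by
  classical
  induction m with
  | zero =>
    intro s t S hS hpos
    obtain ⟨x, hx⟩ := Module.finrank_pos_iff_exists_ne_zero.1 hpos
    exact absurd (Subtype.ext (funext fun e => x.2.1 e (by simp [Finset.card_eq_zero.1 hS]))) hx
  | succ m ih =>
    intro s t S hS hpos
    by_cases hloop : ∃ e ∈ S, s e = t e
    · obtain ⟨e, he, hst⟩ := hloop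
      refine ⟨_, single_mem_cycleSpace he hst, fun h => ?_, isUnitChain_single e, {e}, ?_,
        fun e' he' => ⟨e, Finset.mem_singleton_self e, fun x _ => ?_⟩⟩
      · simpa using congrFun h e
      · rw [Finset.card_singleton, circuitBound]; omega
      · by_cases h : e' = e
        · rw [h]
        · exact absurd (Pi.single_eq_of_ne h _) he'
    push Not at hloop
    by_cases hbridge : ∃ e ∈ S, ∀ x ∈ cycleSpace s t S, x e = 0
    · obtain ⟨e, he, h0⟩ := hbridge
      have heq : cycleSpace s t (S.erase e) = cycleSpace s t S := by
        ext x
        rw [mem_cycleSpace_erase]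
        exact ⟨And.left, fun h => ⟨h, h0 x h⟩⟩
      have := ih s t (S.erase e) (by rw [Finset.card_erase_of_mem he, hS]; rfl)
      rw [heq] at this
      exact this hpos
    push Not at hbridge
    by_cases hseries : ∃ e ∈ S, ∃ f ∈ S, e ≠ f ∧ ∀ x ∈ cycleSpace s t S, |x e| = |x f|
    · obtain ⟨e, he, f, hf, hef, hpar⟩ := hseries
      have hfl := hloop f hf
      obtain ⟨z, hz, hz0, hzu, A, hA, hcov⟩ := ih (contractVertex s t f ∘ s)
        (contractVertex s t f ∘ t) (S.erase f) (by rw [Finset.card_erase_of_mem hf, hS]; rfl)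
        (by rwa [finrank_cycleSpace_contract hf hfl])
      rw [finrank_cycleSpace_contract hf hfl] at hA
      obtain ⟨z, hz', rfl⟩ := exists_update_eq_of_mem_cycleSpace_contract hf hz
      have hze : ∀ g, g ≠ f → Function.update z f 0 g = z g := fun g hg =>
        Function.update_of_ne hg _ _
      have hcov' : ∀ g, g ≠ f → z g ≠ 0 → ∃ a ∈ A, ∀ x ∈ cycleSpace s t S, |x g| = |x a| := by
        intro g hg hzg
        obtain ⟨a, ha, hax⟩ := hcov g (by rwa [hze g hg])
        refine ⟨a, ha, fun x hx => ?_⟩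
        -- The contracted chain vanishes at `f` but not at `g`, so `f` cannot represent the class of
        -- `g`.
        have haf : a ≠ f := by
          rintro rfl
          have := hax _ (update_mem_cycleSpace_contract hz')
          rw [Function.update_self, hze g hg, abs_zero, abs_eq_zero] at this
          exact hzg this
        have := hax _ (update_mem_cycleSpace_contract (f := f) hx)
        rwa [Function.update_of_ne hg, Function.update_of_ne haf] at this
      refine ⟨z, hz', fun h => hz0 (by rw [h]; simp), fun g => ?_, A, hA, fun g hg => ?_⟩
      -- The lifted value on the contracted edge is again 0 or ±1, because `f` is in series with
      -- `e`.
      · by_cases hg : g = f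
        · rw [hg]
          have h1 := hpar z hz'
          have h2 := hzu e
          rw [hze e hef] at h2
          rcases h2 with h2 | h2 | h2
          · rw [h2, abs_zero, eq_comm, abs_eq_zero] at h1
            exact Or.inl h1
          · rw [h2, abs_one, eq_comm, abs_eq zero_le_one] at h1
            exact Or.inr h1
          · rw [h2, abs_neg, abs_one, eq_comm, abs_eq zero_le_one] at h1
            exact Or.inr h1
        · rw [← hze g hg]; exact hzu g
      · by_cases hgf : g = f
        · subst hgf
          have hze0 : z e ≠ 0 := fun h => by
            have h1 := hpar z hz'
            rw [h, abs_zero, eq_comm, abs_eq_zero] at h1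
            exact hg h1
          obtain ⟨a, ha, hax⟩ := hcov' e hef hze0
          exact ⟨a, ha, fun x hx => by rw [← hpar x hx, hax x hx]⟩
        · exact hcov' g hgf hg
    push Not at hseries
    obtain ⟨n, hn, x, e, hc, he⟩ := exists_short_circuit_of_reduced hpos hloop hbridge hseries
    obtain ⟨z, hz, hzu, hz0, hzs⟩ := hc.exists_cycle he
    refine ⟨z, hz, fun h => hz0 0 (by rw [h]; rfl), hzu, Finset.univ.image e, ?_, fun f hf => ?_⟩
    · refine Finset.card_image_le.trans ?_
      rw [Finset.card_univ, ZMod.card]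
      exact hn
    · obtain ⟨i, rfl⟩ := hzs f hf
      exact ⟨e i, Finset.mem_image_of_mem _ (Finset.mem_univ i), fun _ _ => rfl⟩

end OrientedMultigraph

namespace OrientedMultigraph

variable {V E : Type*} [Fintype E] {s t : E → V} {S : Finset E}

/-! ### Triangular families of cycles with heavy series classes -/

open scoped Classical in
-- The norm of a unit cycle is the weight of its support, which is covered by at most `circuitBound`
-- classes; the heaviest of these carries at least the average.
theorem exists_heavy_class {w : E → ℝ} (hw : ∀ e, 0 ≤ w e) {σ : ℝ}
    (hpos : 0 < Module.finrank ℝ (cycleSpace s t S))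
    (hσ : ∀ z ∈ cycleSpace s t S, IsUnitChain z → z ≠ 0 → σ ≤ ∑ e, w e * z e ^ 2) :
    ∃ c, ∃ l ∈ cycleSpace s t S, IsUnitChain l ∧ l c = 1 ∧
      σ ≤ circuitBound (Module.finrank ℝ (cycleSpace s t S)) *
        ∑ e with ∀ x ∈ cycleSpace s t S, |x e| = |x c|, w e := by
  obtain ⟨z, hz, hz0, hzu, A, hA, hcov⟩ := exists_cycle_of_few_classes S.card s t S rfl hpos
  set N := circuitBound (Module.finrank ℝ (cycleSpace s t S)) with hN
  set W : E → ℝ := fun c => ∑ e with ∀ x ∈ cycleSpace s t S, |x e| = |x c|, w e with hW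
  have hW0 : ∀ c, 0 ≤ W c := fun c => Finset.sum_nonneg fun e _ => hw e
  have hsum : ∑ e, w e * z e ^ 2 ≤ ∑ a ∈ A with z a ≠ 0, W a := by
    have h1 : ∀ e, w e * z e ^ 2 ≤ ∑ a ∈ A with z a ≠ 0,
        if ∀ x ∈ cycleSpace s t S, |x e| = |x a| then w e else 0 := by
      intro e
      by_cases he : z e = 0
      · rw [he]
        refine le_trans (by simp) (Finset.sum_nonneg fun a _ => ?_)
        split_ifs
        · exact hw e
        · exact le_rfl
      · obtain ⟨a, ha, hax⟩ := hcov e he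
        have hza : z a ≠ 0 := by
          rw [← abs_pos, ← hax z hz, abs_pos]; exact he
        have hsq : z e ^ 2 = 1 := by
          rcases hzu e with h | h | h
          · exact absurd h he
          · rw [h]; norm_num
          · rw [h]; norm_num
        rw [hsq, mul_one]
        refine le_trans (le_of_eq ?_) (Finset.single_le_sum (f := fun a =>
          if ∀ x ∈ cycleSpace s t S, |x e| = |x a| then w e else 0) (fun b _ => ?_)
          (Finset.mem_filter.2 ⟨ha, hza⟩))
        · exact (if_pos hax).symm
        · split_ifs
          · exact hw e
          · exact le_rfl
    refine (Finset.sum_le_sum fun e _ => h1 e).trans (le_of_eq ?_)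
    rw [Finset.sum_comm]
    exact Finset.sum_congr rfl fun a _ => (Finset.sum_filter _ _).symm
  obtain ⟨e₀, he₀⟩ := Function.ne_iff.1 hz0
  have hne : (A.filter fun a => z a ≠ 0).Nonempty := by
    obtain ⟨a, ha, hax⟩ := hcov e₀ he₀
    refine ⟨a, Finset.mem_filter.2 ⟨ha, ?_⟩⟩
    rw [← abs_pos, ← hax z hz, abs_pos]; exact he₀
  obtain ⟨c, hc, hmax⟩ := Finset.exists_max_image _ W hne
  have hσc : σ ≤ N * W c := by
    refine (hσ z hz hzu hz0).trans (hsum.trans ((Finset.sum_le_card_nsmul _ _ _ hmax).trans ?_))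
    rw [nsmul_eq_mul]
    refine mul_le_mul_of_nonneg_right ?_ (hW0 c)
    exact_mod_cast (Finset.card_filter_le _ _).trans hA
  rcases hzu c with h | h | h
  · exact absurd h (Finset.mem_filter.1 hc).2
  · exact ⟨c, z, hz, hzu, h, hσc⟩
  · refine ⟨c, -z, (cycleSpace s t S).neg_mem hz, fun e => ?_, by simp [h], hσc⟩
    rcases hzu e with h | h | h <;> simp [h]

open scoped Classical in
/-- The edges in series with `c j` after the edges `c i`, `j < i < k`, have been deleted. -/
noncomputable def seriesClass (s t : E → V) (S : Finset E) (k : ℕ) (c : ℕ → E) (j : ℕ) :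
    Finset E :=
  {e | ∀ x ∈ cycleSpace s t S, (∀ i, j < i → i < k → x (c i) = 0) → |x e| = |x (c j)|}

theorem mem_seriesClass {k : ℕ} {c : ℕ → E} {j : ℕ} {e : E} : e ∈ seriesClass s t S k c j ↔
    ∀ x ∈ cycleSpace s t S, (∀ i, j < i → i < k → x (c i) = 0) → |x e| = |x (c j)| := by
  simp [seriesClass]

/-- The cycles `l j`, `j < k`, are triangular with respect to the edges `c j`, which have series
classes of large weight and separate the points of the cycle space. -/
structure IsHeavyFlag (s t : E → V) (S : Finset E) (w : E → ℝ) (σ : ℝ) (k : ℕ) (c : ℕ → E)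
    (l : ℕ → E → ℝ) : Prop where
  mem : ∀ j < k, l j ∈ cycleSpace s t S
  isUnitChain : ∀ j < k, IsUnitChain (l j)
  diag : ∀ j < k, l j (c j) = 1
  upper : ∀ j i, j < i → i < k → l j (c i) = 0
  eq_zero : ∀ x ∈ cycleSpace s t S, (∀ i < k, x (c i) = 0) → x = 0
  weight : ∀ j < k, σ ≤ circuitBound (j + 1) * ∑ e ∈ seriesClass s t S k c j, w e

theorem finrank_cycleSpace_erase [DecidableEq E] {l : E → ℝ} {c : E}
    (hl : l ∈ cycleSpace s t S) (hlc : l c = 1) :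
    Module.finrank ℝ (cycleSpace s t (S.erase c)) + 1 = Module.finrank ℝ (cycleSpace s t S) := by
  let p : cycleSpace s t S →ₗ[ℝ] ℝ :=
    (LinearMap.proj (R := ℝ) (φ := fun _ => ℝ) c).comp (cycleSpace s t S).subtype
  have hsurj : Function.Surjective p := fun r => ⟨r • ⟨l, hl⟩, by
    change r * l c = r
    rw [hlc, mul_one]⟩
  have h1 := LinearMap.finrank_range_add_finrank_ker p
  rw [LinearMap.range_eq_top.2 hsurj, finrank_top, Module.finrank_self] at h1
  have h2 : Module.finrank ℝ (cycleSpace s t (S.erase c)) =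
      Module.finrank ℝ (LinearMap.ker p) := by
    refine LinearEquiv.finrank_eq ⟨⟨⟨fun x => ⟨⟨x.1, (mem_cycleSpace_erase.1 x.2).1⟩,
      (mem_cycleSpace_erase.1 x.2).2⟩, fun _ _ => rfl⟩, fun _ _ => rfl⟩,
      fun x => ⟨x.1.1, mem_cycleSpace_erase.2 ⟨x.1.2, x.2⟩⟩, fun _ => rfl, fun _ => rfl⟩
  omega

/-- The first edge found gets the top index `k`, and the flag of the graph without it fills the
indices below. Hence index j is treated when the rank is j + 1. Cycles of the smaller graph are
cycles of the larger one, so the bound `σ` persists. -/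
theorem exists_isHeavyFlag [Nonempty E] {w : E → ℝ} (hw : ∀ e, 0 ≤ w e) {σ : ℝ} (k : ℕ) :
    ∀ S : Finset E, Module.finrank ℝ (cycleSpace s t S) = k →
    (∀ z ∈ cycleSpace s t S, IsUnitChain z → z ≠ 0 → σ ≤ ∑ e, w e * z e ^ 2) →
    ∃ c l, IsHeavyFlag s t S w σ k c l := by
  classical
  induction k with
  | zero =>
    intro S hS _
    refine ⟨fun _ => Classical.arbitrary E, 0, by simp, by simp, by simp, by simp,
      fun x hx _ => ?_, by simp⟩
    rw [Submodule.finrank_eq_zero] at hS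
    rw [hS] at hx
    exact hx
  | succ k ih =>
    intro S hS hσ
    obtain ⟨c₀, l₀, hl₀, hu₀, hd₀, hW₀⟩ := exists_heavy_class hw (by omega) hσ
    obtain ⟨c, l, h⟩ := ih (S.erase c₀)
      (by have := finrank_cycleSpace_erase hl₀ hd₀; omega)
      (fun z hz => hσ z (mem_cycleSpace_erase.1 hz).1)
    have hc : ∀ j < k, Function.update c k c₀ j = c j := fun j hj =>
      Function.update_of_ne hj.ne _ _
    have hl : ∀ j < k, Function.update l k l₀ j = l j := fun j hj =>
      Function.update_of_ne hj.ne _ _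
    have hck : Function.update c k c₀ k = c₀ := Function.update_self ..
    have hlk : Function.update l k l₀ k = l₀ := Function.update_self ..
    -- Vanishing at the new top edge is the same as being a cycle after its deletion.
    have hclass : ∀ j < k, seriesClass s t S (k + 1) (Function.update c k c₀) j =
        seriesClass s t (S.erase c₀) k c j := by
      intro j hj
      ext e
      rw [mem_seriesClass, mem_seriesClass, hc j hj]
      constructor
      · intro he x hx hxi
        rw [mem_cycleSpace_erase] at hx
        refine he x hx.1 fun i hji hi => ?_
        rcases Nat.lt_succ_iff_lt_or_eq.1 hi with hi | rfl
        · rw [hc i hi]; exact hxi i hji hi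
        · rw [hck]; exact hx.2
      · intro he x hx hxi
        refine he x (mem_cycleSpace_erase.2 ⟨hx, ?_⟩) fun i hji hi => ?_
        · rw [← hck]; exact hxi k hj (Nat.lt_succ_self k)
        · rw [← hc i hi]; exact hxi i hji (by omega)
    refine ⟨Function.update c k c₀, Function.update l k l₀, fun j hj => ?_, fun j hj => ?_,
      fun j hj => ?_, fun j i hji hi => ?_, fun x hx hxi => ?_, fun j hj => ?_⟩
    · rcases Nat.lt_succ_iff_lt_or_eq.1 hj with hj | rfl
      · rw [hl j hj]; exact (mem_cycleSpace_erase.1 (h.mem j hj)).1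
      · rwa [hlk]
    · rcases Nat.lt_succ_iff_lt_or_eq.1 hj with hj | rfl
      · rw [hl j hj]; exact h.isUnitChain j hj
      · rwa [hlk]
    · rcases Nat.lt_succ_iff_lt_or_eq.1 hj with hj | rfl
      · rw [hl j hj, hc j hj]; exact h.diag j hj
      · rwa [hlk, hck]
    · rcases Nat.lt_succ_iff_lt_or_eq.1 hi with hi | rfl
      · rw [hl j (by omega), hc i hi]; exact h.upper j i hji hi
      · rw [hl j hji, hck]; exact (mem_cycleSpace_erase.1 (h.mem j hji)).2
    · refine h.eq_zero x (mem_cycleSpace_erase.2 ⟨hx, ?_⟩) fun i hi => ?_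
      · rw [← hck]; exact hxi k (Nat.lt_succ_self k)
      · rw [← hc i hi]; exact hxi i (by omega)
    · rcases Nat.lt_succ_iff_lt_or_eq.1 hj with hj | rfl
      · rw [hclass j hj]; exact h.weight j hj
      · rw [hS] at hW₀
        refine hW₀.trans (le_of_eq ?_)
        congr 1
        refine Finset.sum_congr (Finset.ext fun e => ?_) fun _ _ => rfl
        rw [mem_seriesClass, Finset.mem_filter, hck]
        refine ⟨fun he x hx _ => he.2 x hx, fun he => ⟨Finset.mem_univ _, fun x hx => ?_⟩⟩
        exact he x hx fun i h1 h2 => by omega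

/-! ### Comparison with the logarithmic bound -/

theorem circuitBound_le_logb {k : ℕ} (hk : 2 ≤ k) :
    (circuitBound k : ℝ) ≤ 4 * Real.logb 2 (8 / 3 * (k : ℝ)) := by
  have hk' : (2 : ℝ) ≤ k := by exact_mod_cast hk
  have h1 : (Nat.log 2 (2 * k - 2) : ℝ) ≤ Real.logb 2 (2 * k - 2) := by
    have := Real.natLog_le_logb (2 * k - 2) 2
    rw [Nat.cast_sub (by omega)] at this
    exact_mod_cast this
  -- This amounts to 4(2k - 2) ≤ (8k/3)², a quadratic inequality with negative discriminant.
  have h2 : Real.logb 2 (2 * k - 2) + 2 ≤ 2 * Real.logb 2 (8 / 3 * (k : ℝ)) := by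
    have h4 : (2 : ℝ) = Real.logb 2 4 := by
      rw [show (4 : ℝ) = 2 ^ (2 : ℝ) by norm_num, Real.logb_rpow (by norm_num) (by norm_num)]
    calc Real.logb 2 (2 * k - 2) + 2 = Real.logb 2 ((2 * k - 2) * 4) := by
          rw [Real.logb_mul (by linarith) (by norm_num), ← h4]
      _ ≤ Real.logb 2 ((8 / 3 * (k : ℝ)) ^ 2) :=
          Real.logb_le_logb_of_le (by norm_num) (by nlinarith) (by nlinarith)
      _ = 2 * Real.logb 2 (8 / 3 * (k : ℝ)) := by
          rw [Real.logb_pow]; norm_num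
  unfold circuitBound
  push_cast
  linarith

theorem prod_circuitBound_le {b : ℕ} (hb : 1 ≤ b) :
    (∏ j ∈ Finset.range b, (circuitBound (j + 1) : ℝ)) ≤
      4 ^ b * ∏ k ∈ Finset.Icc 2 b, Real.logb 2 (8 / 3 * (k : ℝ)) := by
  induction b, hb using Nat.le_induction with
  | base => simp [circuitBound]
  | succ b hb ih =>
    rw [Finset.prod_range_succ, Finset.prod_Icc_succ_top (by omega), pow_succ]
    calc _ ≤ (4 ^ b * ∏ k ∈ Finset.Icc 2 b, Real.logb 2 (8 / 3 * (k : ℝ))) *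
          (4 * Real.logb 2 (8 / 3 * ((b + 1 : ℕ) : ℝ))) :=
          mul_le_mul ih (circuitBound_le_logb (by omega)) (by positivity)
            ((Finset.prod_nonneg fun _ _ => by positivity).trans ih)
      _ = _ := by ring

theorem IsHeavyFlag.pow_le {w : E → ℝ} {σ : ℝ} (hσ : 0 ≤ σ) {k : ℕ} (hk : 1 ≤ k) {c : ℕ → E}
    {l : ℕ → E → ℝ} (h : IsHeavyFlag s t S w σ k c l) (hw : ∀ e, 0 ≤ w e) :
    σ ^ k ≤ (4 ^ k * ∏ i ∈ Finset.Icc 2 k, Real.logb 2 (8 / 3 * (i : ℝ))) *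
      ∏ j ∈ Finset.range k, ∑ e ∈ seriesClass s t S k c j, w e := by
  calc σ ^ k = ∏ _j ∈ Finset.range k, σ := by simp
    _ ≤ ∏ j ∈ Finset.range k, (circuitBound (j + 1) * ∑ e ∈ seriesClass s t S k c j, w e) :=
        Finset.prod_le_prod (fun _ _ => hσ) fun j hj => h.weight j (Finset.mem_range.1 hj)
    _ ≤ _ := by
        rw [Finset.prod_mul_distrib]
        exact mul_le_mul_of_nonneg_right (prod_circuitBound_le hk)
          (Finset.prod_nonneg fun j _ => Finset.sum_nonneg fun e _ => hw e)

end OrientedMultigraph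

/-! ## Determinants of lattices -/

open InnerProductSpace in
-- In the Gram–Schmidt orthonormal basis the matrix of `b` is triangular, and each diagonal entry is
-- the distance from `b j` to the span of its predecessors. The determinant of the lattice is the
-- product of the squares of these distances.
theorem prod_le_latticeDet_span {E : Type*} [NormedAddCommGroup E] [InnerProductSpace ℝ E]
    [FiniteDimensional ℝ E] [MeasurableSpace E] [BorelSpace E] {n : ℕ}
    (b : Module.Basis (Fin n) ℝ E) (p : Fin n → ℝ) (hp : ∀ j, 0 ≤ p j)
    (h : ∀ j, ∀ y ∈ Submodule.span ℝ (b '' Set.Iio j), p j ≤ ‖b j - y‖ ^ 2) :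
    ∏ j, p j ≤ latticeDet (Submodule.span ℤ (Set.range b)) ∧
      0 < latticeDet (Submodule.span ℤ (Set.range b)) := by
  classical
  have hn : Module.finrank ℝ E = Fintype.card (Fin n) := Module.finrank_eq_card_basis b
  set o := gramSchmidtOrthonormalBasis hn b with ho
  have hcov : ZLattice.covolume (Submodule.span ℤ (Set.range b)) = |o.toBasis.det b| := by
    rw [ZLattice.covolume_eq_det_mul_measureReal _ _ (b.restrictScalars ℤ) o.toBasis]
    have h1 : (MeasureTheory.volume : MeasureTheory.Measure E).real
        (ZSpan.fundamentalDomain o.toBasis) = 1 := by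
      rw [MeasureTheory.measureReal_congr (ZSpan.fundamentalDomain_ae_parallelepiped o.toBasis _),
        MeasureTheory.measureReal_def]
      simp [o.volume_parallelepiped]
    rw [h1, mul_one]
    congr 2
    ext i
    simp
  have hinner : ∀ j, p j ≤ ⟪o j, b j⟫ ^ 2 := by
    intro j
    have hgs := gramSchmidt_ne_zero (𝕜 := ℝ) j b.linearIndependent
    have hoj : o j = (‖gramSchmidt ℝ b j‖ : ℝ)⁻¹ • gramSchmidt ℝ b j := by
      rw [ho, gramSchmidtOrthonormalBasis_apply]
      · rfl
      · intro h0
        have := gramSchmidtNormed_unit_length (𝕜 := ℝ) j b.linearIndependent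
        rw [h0, norm_zero] at this
        exact zero_ne_one this
    have hdef := gramSchmidt_def'' ℝ b j
    have hin : ⟪gramSchmidt ℝ b j, b j⟫ = ‖gramSchmidt ℝ b j‖ ^ 2 := by
      conv_lhs => rw [hdef]
      rw [inner_add_right, inner_sum, Finset.sum_eq_zero, add_zero, real_inner_self_eq_norm_sq]
      intro i hi
      rw [inner_smul_right, gramSchmidt_orthogonal ℝ b (Finset.mem_Iio.1 hi).ne', mul_zero]
    have hle := h j (b j - gramSchmidt ℝ b j) (by
      rw [← span_gramSchmidt_Iio ℝ b j]
      rw [sub_eq_of_eq_add' hdef]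
      refine Submodule.sum_mem _ fun i hi => Submodule.smul_mem _ _ (Submodule.subset_span ?_)
      exact Set.mem_image_of_mem _ (Finset.mem_Iio.1 hi))
    rw [sub_sub_cancel] at hle
    rw [hoj, real_inner_smul_left, hin]
    have hnz : ‖gramSchmidt ℝ b j‖ ≠ 0 := norm_ne_zero_iff.2 hgs
    rwa [pow_two ‖gramSchmidt ℝ b j‖, inv_mul_cancel_left₀ hnz]
  refine ⟨?_, ?_⟩
  · rw [latticeDet, hcov, sq_abs, gramSchmidtOrthonormalBasis_det, ← Finset.prod_pow]
    exact Finset.prod_le_prod (fun j _ => hp j) fun j _ => hinner j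
  · rw [latticeDet]
    exact pow_pos (ZLattice.covolume_pos _ _) 2

namespace OrientedMultigraph

variable {V E : Type*} [Fintype E] {s t : E → V} {S : Finset E}

/-! ### Transversals of the series classes -/

section Transversal

variable {w : E → ℝ} {σ : ℝ} {k : ℕ} {c : ℕ → E} {l : ℕ → E → ℝ} {f : ℕ → E}

theorem IsHeavyFlag.apply_eq_zero (h : IsHeavyFlag s t S w σ k c l) {i j : ℕ} (hji : j < i)
    (hi : i < k) {e : E} (he : e ∈ seriesClass s t S k c i) : l j e = 0 := by
  have := mem_seriesClass.1 he (l j) (h.mem j (hji.trans hi))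
    fun m him hm => h.upper j m (hji.trans him) hm
  rwa [h.upper j i hji hi, abs_zero, abs_eq_zero] at this

theorem IsHeavyFlag.abs_apply_eq_one (h : IsHeavyFlag s t S w σ k c l) {j : ℕ} (hj : j < k)
    {e : E} (he : e ∈ seriesClass s t S k c j) : |l j e| = 1 := by
  rw [mem_seriesClass.1 he (l j) (h.mem j hj) fun m hjm hm => h.upper j m hjm hm, h.diag j hj,
    abs_one]

theorem IsHeavyFlag.eq_of_mem_seriesClass (h : IsHeavyFlag s t S w σ k c l) {i j : ℕ}
    (hi : i < k) (hj : j < k) {e : E} (hei : e ∈ seriesClass s t S k c i)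
    (hej : e ∈ seriesClass s t S k c j) : i = j := by
  wlog hij : i < j generalizing i j
  · rcases lt_trichotomy i j with h' | h' | h'
    · exact absurd h' hij
    · exact h'
    · exact (this hj hi hej hei h').symm
  have h1 := h.abs_apply_eq_one hi hei
  rw [h.apply_eq_zero hij hj hej, abs_zero] at h1
  exact absurd h1 zero_ne_one

/-- Descending induction on the index: once `x` vanishes at all later `c i`, it has the same
absolute value at `f j` and `c j`. Hence no circuit avoids the transversal. -/
theorem IsHeavyFlag.eq_zero_of_transversal (h : IsHeavyFlag s t S w σ k c l)
    (hf : ∀ j < k, f j ∈ seriesClass s t S k c j) {x : E → ℝ} (hx : x ∈ cycleSpace s t S)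
    (hxf : ∀ j < k, x (f j) = 0) : x = 0 := by
  have key : ∀ m j, k = j + 1 + m → x (c j) = 0 := by
    intro m
    induction m using Nat.strong_induction_on with
    | _ m ih =>
    intro j hj
    have := mem_seriesClass.1 (hf j (by omega)) x hx fun i hji hi =>
      ih (k - i - 1) (by omega) i (by omega)
    rwa [hxf j (by omega), abs_zero, eq_comm, abs_eq_zero] at this
  exact h.eq_zero x hx fun j hj => key (k - j - 1) j (by omega)

/-- A cut that consists of edges of the transversal is empty. -/
theorem IsHeavyFlag.cut_eq_empty (h : IsHeavyFlag s t S w σ k c l)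
    (hf : ∀ j < k, f j ∈ seriesClass s t S k c j) (P : V → Prop)
    (hP : ∀ e, (∀ j < k, f j ≠ e) → (P (s e) ↔ P (t e))) (e : E) : P (s e) ↔ P (t e) := by
  classical
  by_contra hcon
  have hex : ∃ j, j < k ∧ ¬ (P (s (f j)) ↔ P (t (f j))) := by
    by_contra! hno
    refine hcon (hP e fun j hj hje => hcon ?_)
    rw [← hje]
    exact hno j hj
  obtain ⟨hj, hcross⟩ := Nat.find_spec hex
  set j := Nat.find hex with hjdef
  -- A cycle has zero net flow across the cut. For the smallest crossing index `j`, the cycle `l j`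
  -- vanishes on all later transversal edges, so `f j` alone would contribute ±1.
  have hsum := (h.mem j hj).2 (fun v => if P v then 1 else 0)
  rw [Finset.sum_eq_single (f j)] at hsum
  · have h1 : l j (f j) ≠ 0 := fun h0 => by
      have := h.abs_apply_eq_one hj (hf j hj)
      rw [h0, abs_zero] at this
      exact zero_ne_one this
    rcases mul_eq_zero.1 hsum with h2 | h2
    · exact h1 h2
    · by_cases hs : P (s (f j)) <;> by_cases ht : P (t (f j)) <;> simp_all
  · intro g _ hg
    by_cases hgP : P (s g) ↔ P (t g)
    · simp [hgP]
    · obtain ⟨i, hi, rfl⟩ : ∃ i, i < k ∧ f i = g := by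
        by_contra! hno
        exact hgP (hP g hno)
      have hji : j < i := by
        refine lt_of_le_of_ne (Nat.find_min' hex ⟨hi, hgP⟩) fun h' => hg (by rw [← h'])
      rw [h.apply_eq_zero hji hi (hf i hi), zero_mul]
  · simp

end Transversal

end OrientedMultigraph

/-! ### Application to connected multigraphs -/

namespace Graph

open OrientedMultigraph

variable {α β : Type*} {G : Graph α β}

theorem exists_orientation (G : Graph α β) : Nonempty G.Orientation := by
  choose x y h using fun e : E(G) => G.exists_isLink_of_mem_edgeSet e.2
  exact ⟨⟨x, y, h⟩⟩

namespace Orientation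

theorem hasSimpleCircuit_of_isCircuit (o : G.Orientation) {n : ℕ} [NeZero n] {x : ZMod n → α}
    {e : ZMod n → E(G)} (h : IsCircuit o.src o.tgt x e) : G.HasSimpleCircuit n := by
  refine ⟨Nat.pos_of_ne_zero (NeZero.ne n), x, fun i => (e i).1, h.vertex_injective,
    Subtype.val_injective.comp h.edge_injective, fun i => ?_⟩
  have := o.isLink (e i)
  rcases h.link i with ⟨h1, h2⟩ | ⟨h1, h2⟩
  · rwa [h1, h2] at this
  · rw [h1, h2] at this
    exact this.symm

theorem exists_isCircuit_of_restrict (o : G.Orientation) {T : Set β} {n : ℕ}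
    (h : (G.restrict T).HasSimpleCircuit n) :
    0 < n ∧ ∃ (x : ZMod n → α) (e : ZMod n → E(G)), IsCircuit o.src o.tgt x e ∧
      ∀ i, (e i).1 ∈ T := by
  obtain ⟨hn, x, e, hx, he, hlink⟩ := h
  refine ⟨hn, x, fun i => ⟨e i, (hlink i).2.edge_mem⟩,
    ⟨hx, fun i j hij => he (congrArg Subtype.val hij), fun i => ?_⟩, fun i => (hlink i).1⟩
  rcases (o.isLink ⟨e i, (hlink i).2.edge_mem⟩).eq_and_eq_or_eq_and_eq (hlink i).2 with h | h
  · exact Or.inl h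
  · exact Or.inr ⟨h.2, h.1⟩

variable [Fintype E(G)] (o : G.Orientation)

theorem mem_homology_iff {R : Type*} [CommRing R] {x : E(G) → R} : x ∈ o.homology R ↔
    ∀ φ : α → R, ∑ e, x e * (φ (o.tgt e) - φ (o.src e)) = 0 := by
  classical
  rw [homology, LinearMap.mem_ker, boundary, Fintype.linearCombination_apply]
  constructor
  · intro h φ
    have := congrArg (Finsupp.linearCombination R φ) h
    simpa [map_sum] using this
  · intro h
    ext v
    have := h (fun u => if u = v then 1 else 0)
    simpa [Finsupp.finsetSum_apply, Finsupp.single_apply] using this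

theorem homology_eq_cycleSpace :
    o.homology ℝ = cycleSpace o.src o.tgt Finset.univ := by
  ext x
  rw [mem_homology_iff, mem_cycleSpace_univ]

theorem intCast_mem_homology_iff {z : E(G) → ℤ} :
    z ∈ o.homology ℤ ↔ (fun e => (z e : ℝ)) ∈ o.homology ℝ := by
  classical
  constructor
  · intro h
    rw [homology, LinearMap.mem_ker, boundary, Fintype.linearCombination_apply] at h ⊢
    ext v
    have := congrArg (Int.cast : ℤ → ℝ) (DFunLike.congr_fun h v)
    simpa [Finsupp.finsetSum_apply, Finsupp.single_apply] using this
  · intro h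
    rw [mem_homology_iff] at h
    rw [homology, LinearMap.mem_ker, boundary, Fintype.linearCombination_apply]
    ext v
    have := h (fun u => if u = v then 1 else 0)
    rw [← Int.cast_inj (α := ℝ)]
    simpa [Finsupp.finsetSum_apply, Finsupp.single_apply] using this

theorem finrank_cycleSpace [Finite V(G)] (hconn : G.IsConnected) :
    Module.finrank ℝ (cycleSpace o.src o.tgt Finset.univ) = G.bettiOne := by
  classical
  have hfin : V(G).Finite := Set.toFinite _
  have h := finrank_cycleSpace_univ_add_card (s := o.src) (t := o.tgt) (U := hfin.toFinset)
    (fun e => by simpa using ⟨(o.isLink e).left_mem, (o.isLink e).right_mem⟩)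
    (by simpa using hconn.1)
    (fun u hu v hv => by
      refine Relation.ReflTransGen.mono ?_ u v
        (hconn.2 u (by simpa using hu) v (by simpa using hv))
      rintro a b ⟨e, he⟩
      refine ⟨⟨e, he.edge_mem⟩, ?_⟩
      rcases (o.isLink ⟨e, he.edge_mem⟩).eq_and_eq_or_eq_and_eq he with h | h
      · exact Or.inl h
      · exact Or.inr h)
  rw [bettiOne, Set.ncard_eq_toFinset_card V(G) hfin, ← Nat.card_coe_set_eq,
    Nat.card_eq_fintype_card]
  omega

theorem nonempty_edgeSet [Finite V(G)] (hconn : G.IsConnected) (hb : 1 ≤ G.bettiOne) :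
    Nonempty E(G) := by
  obtain ⟨o⟩ := G.exists_orientation
  by_contra hempty
  rw [not_nonempty_iff] at hempty
  have h1 := o.finrank_cycleSpace hconn
  have h2 := (cycleSpace o.src o.tgt Finset.univ).finrank_le
  rw [Module.finrank_fintype_fun_eq_card, Fintype.card_eq_zero] at h2
  omega

/-! ### The complexity -/

theorem systole_le_sum_sq {z : E(G) → ℝ} (hz : z ∈ cycleSpace o.src o.tgt Finset.univ)
    (hzu : IsUnitChain z) (hz0 : z ≠ 0) : (G.systole : ℝ) ≤ ∑ e, 1 * z e ^ 2 := by
  classical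
  obtain ⟨n, x, e, hc, he⟩ := exists_circuit_of_mem_cycleSpace hz hz0
  -- The support of the cycle contains a circuit, and for unit weights the norm is the size of the
  -- support.
  have h1 : G.systole ≤ n + 1 := Nat.sInf_le (o.hasSimpleCircuit_of_isCircuit hc)
  have h2 : n + 1 ≤ (Finset.univ.filter fun e => z e ≠ 0).card := by
    rw [← ZMod.card (n + 1), ← Finset.card_univ, ← Finset.card_image_of_injective _
      hc.edge_injective]
    refine Finset.card_le_card fun f hf => ?_
    obtain ⟨i, -, rfl⟩ := Finset.mem_image.1 hf
    simpa using he i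
  have h3 : ∑ e, 1 * z e ^ 2 = ((Finset.univ.filter fun e => z e ≠ 0).card : ℝ) := by
    rw [Finset.card_filter, Nat.cast_sum]
    refine Finset.sum_congr rfl fun e _ => ?_
    rcases hzu e with h | h | h <;> simp [h]
  rw [h3]
  exact_mod_cast h1.trans h2

theorem isSpanningTree_of_transversal (hconn : G.IsConnected) {w : E(G) → ℝ} {σ : ℝ} {k : ℕ}
    {c : ℕ → E(G)} {l : ℕ → E(G) → ℝ}
    (h : IsHeavyFlag o.src o.tgt Finset.univ w σ k c l) {f : ℕ → E(G)}
    (hf : ∀ j < k, f j ∈ seriesClass o.src o.tgt Finset.univ k c j) :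
    G.IsSpanningTree (Subtype.val '' {e : E(G) | ∀ j < k, f j ≠ e}) := by
  refine ⟨?_, ⟨hconn.1, fun x hx y hy => ?_⟩, fun n hn => ?_⟩
  · rintro _ ⟨e, -, rfl⟩
    exact e.2
  · set T : Set β := Subtype.val '' {e : E(G) | ∀ j < k, f j ≠ e} with hT
    -- The cut around the set of vertices reachable from `x` in the complement of the transversal.
    have hcut := h.cut_eq_empty hf (fun v => Relation.ReflTransGen (G.restrict T).Adj x v)
      (fun e he => by
        have hadj : (G.restrict T).Adj (o.src e) (o.tgt e) := ⟨e, ⟨e, he, rfl⟩, o.isLink e⟩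
        exact ⟨fun h => h.tail hadj, fun h => h.tail hadj.symm⟩)
    have hx' : x ∈ V(G) := hx
    have hy' : y ∈ V(G) := hy
    induction hconn.2 x hx' y hy' with
    | refl => exact Relation.ReflTransGen.refl
    | @tail a b _ hab ih =>
      obtain ⟨e, he⟩ := hab
      have ha := ih he.left_mem he.left_mem
      rcases (o.isLink ⟨e, he.edge_mem⟩).eq_and_eq_or_eq_and_eq he with ⟨h1, h2⟩ | ⟨h1, h2⟩
      · have := hcut ⟨e, he.edge_mem⟩
        rw [h1, h2] at this
        exact this.1 ha
      · have := hcut ⟨e, he.edge_mem⟩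
        rw [h1, h2] at this
        exact this.2 ha
  · obtain ⟨hpos, x, e, hc, he⟩ := o.exists_isCircuit_of_restrict hn
    have : NeZero n := ⟨hpos.ne'⟩
    obtain ⟨z, hz, -, hz0, hzs⟩ := hc.exists_cycle (S := Finset.univ) fun i => Finset.mem_univ _
    refine hz0 0 ?_
    rw [h.eq_zero_of_transversal hf hz fun j hj => ?_]
    · rfl
    · by_contra hne
      obtain ⟨i, hi⟩ := hzs _ hne
      obtain ⟨e', he', hee⟩ := he i
      exact he' j hj (by rw [← hi]; exact (Subtype.ext hee).symm)

/-- Each transversal gives a spanning tree, and the tree recovers the transversal: its complement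
meets the j-th class exactly in the chosen edge, since the classes are disjoint. -/
theorem prod_card_seriesClass_le_complexity (hconn : G.IsConnected) {w : E(G) → ℝ} {σ : ℝ}
    {k : ℕ} {c : ℕ → E(G)} {l : ℕ → E(G) → ℝ}
    (h : IsHeavyFlag o.src o.tgt Finset.univ w σ k c l) :
    ∏ j ∈ Finset.range k, (seriesClass o.src o.tgt Finset.univ k c j).card ≤ G.complexity := by
  classical
  set F : Finset (Fin k → E(G)) :=
    Fintype.piFinset fun j => seriesClass o.src o.tgt Finset.univ k c j with hF
  let ext : (Fin k → E(G)) → ℕ → E(G) := fun f j => if hj : j < k then f ⟨j, hj⟩ else c j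
  let T : (Fin k → E(G)) → Set β := fun f => Subtype.val '' {e : E(G) | ∀ j < k, ext f j ≠ e}
  have hext : ∀ f ∈ F, ∀ j < k, ext f j ∈ seriesClass o.src o.tgt Finset.univ k c j := by
    intro f hf j hj
    simp only [ext, hj, dif_pos]
    exact Fintype.mem_piFinset.1 hf ⟨j, hj⟩
  have hmem : ∀ f (e : E(G)), e.1 ∈ T f ↔ ∀ j < k, ext f j ≠ e := fun f e => by
    constructor
    · rintro ⟨e', he', hee⟩
      rwa [← Subtype.ext hee]
    · exact fun he => ⟨e, he, rfl⟩
  have hinj : Set.InjOn T F := by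
    intro f hf g hg hfg
    funext i
    have h1 : ¬ ∀ j < k, ext g j ≠ f i := by
      rw [← hmem, ← hfg, hmem]
      intro hall
      exact hall i i.2 (by simp [ext])
    push Not at h1
    obtain ⟨j, hj, hji⟩ := h1
    have hij := h.eq_of_mem_seriesClass i.2 hj (Fintype.mem_piFinset.1 hf i)
      (hji ▸ hext g hg j hj)
    rw [← hji]
    simp [ext, ← hij]
  have hfin : {T : Set β | G.IsSpanningTree T}.Finite :=
    (Set.toFinite E(G)).finite_subsets.subset fun T hT => hT.1
  have hcard : ∏ j ∈ Finset.range k, (seriesClass o.src o.tgt Finset.univ k c j).card =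
      F.card := by
    rw [hF, Fintype.card_piFinset, Finset.prod_range]
  rw [hcard, ← Set.ncard_coe_finset F, ← hinj.ncard_image, complexity]
  refine Set.ncard_le_ncard ?_ hfin
  rintro _ ⟨f, hf, rfl⟩
  exact o.isSpanningTree_of_transversal hconn h (hext f hf)

/-! ### The Jacobian -/

variable {w : E(G) → ℝ} (hw : o.IsWeight w)

theorem toChain_injective : Function.Injective (o.toChain hw) := Subtype.val_injective

theorem toChain_mem (x : o.JacobianSpace hw) :
    o.toChain hw x ∈ cycleSpace o.src o.tgt Finset.univ := by
  rw [← homology_eq_cycleSpace]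
  exact x.2

theorem exists_toChain_eq {x : E(G) → ℝ} (hx : x ∈ cycleSpace o.src o.tgt Finset.univ) :
    ∃ y : o.JacobianSpace hw, o.toChain hw y = x := by
  rw [← homology_eq_cycleSpace] at hx
  exact ⟨⟨x, hx⟩, rfl⟩

theorem mem_jacobian_iff {x : o.JacobianSpace hw} :
    x ∈ o.jacobian hw ↔ ∀ e, ∃ n : ℤ, o.toChain hw x e = n := by
  constructor
  · rintro ⟨z, -, hz⟩ e
    exact ⟨z e, hz e⟩
  · intro h
    choose z hz using h
    refine ⟨z, ?_, hz⟩
    rw [intCast_mem_homology_iff, homology_eq_cycleSpace]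
    convert o.toChain_mem hw x using 1
    exact funext fun e => (hz e).symm

theorem mem_jacobian_of_isUnitChain {x : o.JacobianSpace hw} (hx : IsUnitChain (o.toChain hw x)) :
    x ∈ o.jacobian hw := by
  rw [mem_jacobian_iff]
  intro e
  rcases hx e with h | h | h
  · exact ⟨0, by simp [h]⟩
  · exact ⟨1, by simp [h]⟩
  · exact ⟨-1, by simp [h]⟩

theorem finrank_jacobianSpace [Finite V(G)] (hconn : G.IsConnected) :
    Module.finrank ℝ (o.JacobianSpace hw) = G.bettiOne := by
  rw [← o.finrank_cycleSpace hconn, ← homology_eq_cycleSpace]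
  rfl

theorem latticeMinNorm_jacobian_nonneg : 0 ≤ latticeMinNorm (o.jacobian hw) := by
  refine Real.sInf_nonneg ?_
  rintro _ ⟨x, -, -, rfl⟩
  exact real_inner_self_nonneg

theorem latticeMinNorm_jacobian_le {z : E(G) → ℝ}
    (hz : z ∈ cycleSpace o.src o.tgt Finset.univ) (hzu : IsUnitChain z) (hz0 : z ≠ 0) :
    latticeMinNorm (o.jacobian hw) ≤ ∑ e, w e * z e ^ 2 := by
  obtain ⟨y, rfl⟩ := o.exists_toChain_eq hw hz
  refine csInf_le ⟨0, ?_⟩ ⟨y, o.mem_jacobian_of_isUnitChain hw hzu, ?_, ?_⟩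
  · rintro _ ⟨x, -, -, rfl⟩
    exact real_inner_self_nonneg
  · rintro rfl
    exact hz0 (map_zero _)
  · rw [inner_eq]
    exact Finset.sum_congr rfl fun e _ => by ring

/-- The flag is a basis adapted to Gram–Schmidt: subtracting a combination of earlier cycles from `l
j` affects neither the value 1 at `c j` nor the zeros at later `c i`, so the result has absolute
value 1 on the whole j-th class and its norm is at least the weight of that class. -/
theorem prod_weight_le_latticeDet_jacobian {σ : ℝ} {k : ℕ} {c : ℕ → E(G)} {l : ℕ → E(G) → ℝ}
    (h : IsHeavyFlag o.src o.tgt Finset.univ w σ k c l)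
    (hk : Module.finrank ℝ (o.JacobianSpace hw) = k) :
    ∏ j ∈ Finset.range k, ∑ e ∈ seriesClass o.src o.tgt Finset.univ k c j, w e ≤
      latticeDet (o.jacobian hw) ∧ 0 < latticeDet (o.jacobian hw) := by
  classical
  choose v hv using fun j : Fin k => o.exists_toChain_eq hw (h.mem j j.2)
  have hvd : ∀ j : Fin k, o.toChain hw (v j) (c j) = 1 := fun j => by rw [hv, h.diag j j.2]
  have hvu : ∀ j i : Fin k, j < i → o.toChain hw (v j) (c i) = 0 := fun j i hji => by
    rw [hv, h.upper j i hji i.2]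
  -- Triangular elimination from the top index down. It is used over ℝ for spanning and again over
  -- ℤ, where the coefficients are integral because lattice vectors have integral coordinates.
  have hreduce : ∀ (P : o.JacobianSpace hw → Prop), P 0 →
      (∀ x (j : Fin k), P (x - o.toChain hw x (c j) • v j) → P x) → ∀ x, P x := by
    intro P h0 hstep
    have key : ∀ m ≤ k, ∀ x, (∀ i : Fin k, m ≤ i → o.toChain hw x (c i) = 0) → P x := by
      intro m
      induction m with
      | zero =>
        intro _ x hx
        have : x = 0 := o.toChain_injective hw (by
          rw [map_zero]
          exact h.eq_zero _ (o.toChain_mem hw x) fun i hi => hx ⟨i, hi⟩ (Nat.zero_le _))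
        rwa [this]
      | succ m ih =>
        intro hm x hx
        refine hstep x ⟨m, hm⟩ (ih (by omega) _ fun i hi => ?_)
        rw [map_sub, map_smul, Pi.sub_apply, Pi.smul_apply, smul_eq_mul]
        rcases hi.eq_or_lt with hi' | hi'
        · have : i = ⟨m, hm⟩ := Fin.ext hi'.symm
          rw [this, hvd, mul_one, sub_self]
        · rw [hx i hi', hvu _ _ (Fin.lt_def.2 hi'), mul_zero, sub_zero]
    exact fun x => key k le_rfl x fun i hi => absurd i.2 hi.not_gt
  have hspan : ⊤ ≤ Submodule.span ℝ (Set.range v) := fun x _ => by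
    refine hreduce (· ∈ Submodule.span ℝ (Set.range v)) (Submodule.zero_mem _)
      (fun x j hx => ?_) x
    rw [← sub_add_cancel x (o.toChain hw x (c j) • v j)]
    exact Submodule.add_mem _ hx
      (Submodule.smul_mem _ _ (Submodule.subset_span (Set.mem_range_self j)))
  let b := basisOfTopLeSpanOfCardEqFinrank v hspan (by rw [Fintype.card_fin, hk])
  have hb : ⇑b = v := coe_basisOfTopLeSpanOfCardEqFinrank v hspan _
  have hvL : ∀ j, v j ∈ o.jacobian hw := fun j =>
    o.mem_jacobian_of_isUnitChain hw (by rw [hv]; exact h.isUnitChain j j.2)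
  have hL : o.jacobian hw = Submodule.span ℤ (Set.range b) := by
    rw [hb]
    refine le_antisymm (fun x => ?_) (Submodule.span_le.2 (by rintro _ ⟨j, rfl⟩; exact hvL j))
    refine hreduce (fun x => x ∈ o.jacobian hw → x ∈ Submodule.span ℤ (Set.range v))
      (fun _ => Submodule.zero_mem _) (fun x j hx hxL => ?_) x
    obtain ⟨n, hn⟩ := (o.mem_jacobian_iff hw).1 hxL (c j)
    rw [hn, Int.cast_smul_eq_zsmul] at hx
    rw [← sub_add_cancel x (n • v j)]
    exact Submodule.add_mem _ (hx (Submodule.sub_mem _ hxL (Submodule.smul_mem _ _ (hvL j))))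
      (Submodule.smul_mem _ _ (Submodule.subset_span (Set.mem_range_self j)))
  rw [hL, Finset.prod_range]
  refine prod_le_latticeDet_span b
    (fun j => ∑ e ∈ seriesClass o.src o.tgt Finset.univ k c j, w e)
    (fun j => Finset.sum_nonneg fun e _ => hw.nonneg e) fun j y hy => ?_
  rw [hb] at hy ⊢
  have hy0 : ∀ i : Fin k, j ≤ i → o.toChain hw y (c i) = 0 := by
    intro i hji
    induction hy using Submodule.span_induction with
    | mem x hx =>
      obtain ⟨m, hm, rfl⟩ := hx
      exact hvu m i (lt_of_lt_of_le hm hji)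
    | zero => simp
    | add x y _ _ hx hy => rw [map_add, Pi.add_apply, hx, hy, add_zero]
    | smul r x _ hx => rw [map_smul, Pi.smul_apply, hx, smul_zero]
  set x := v j - y with hx
  have hxj : o.toChain hw x (c j) = 1 := by
    rw [hx, map_sub, Pi.sub_apply, hvd, hy0 j le_rfl, sub_zero]
  have habs : ∀ e ∈ seriesClass o.src o.tgt Finset.univ k c j, |o.toChain hw x e| = 1 := by
    intro e he
    rw [mem_seriesClass.1 he _ (o.toChain_mem hw x) fun i hji hi => ?_, hxj, abs_one]
    rw [hx, map_sub, Pi.sub_apply, hvu j ⟨i, hi⟩ (Fin.lt_def.2 hji),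
      hy0 ⟨i, hi⟩ (Fin.le_def.2 (Nat.le_of_lt hji)), sub_zero]
  rw [← real_inner_self_eq_norm_sq, inner_eq]
  calc ∑ e ∈ seriesClass o.src o.tgt Finset.univ k c j, w e
      = ∑ e ∈ seriesClass o.src o.tgt Finset.univ k c j,
        w e * o.toChain hw x e * o.toChain hw x e := by
        refine Finset.sum_congr rfl fun e he => ?_
        rw [mul_assoc, ← abs_mul_abs_self, habs e he, mul_one, mul_one]
    _ ≤ _ := Finset.sum_le_univ_sum_of_nonneg fun e => by
        rw [mul_assoc]
        exact mul_nonneg (hw.nonneg e) (mul_self_nonneg _)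

theorem hermiteInvariant_jacobian_le [Finite V(G)] (hconn : G.IsConnected)
    (hb : 1 ≤ G.bettiOne) :
    hermiteInvariant (o.jacobian hw) ≤
      4 * (∏ k ∈ Finset.Icc 2 G.bettiOne, Real.logb 2 (8 / 3 * (k : ℝ))) ^
        (1 / (G.bettiOne : ℝ)) := by
  have hrank := o.finrank_cycleSpace hconn
  have hne := nonempty_edgeSet hconn hb
  obtain ⟨c, l, h⟩ := exists_isHeavyFlag hw.nonneg G.bettiOne Finset.univ hrank
    fun z hz hzu hz0 => o.latticeMinNorm_jacobian_le hw hz hzu hz0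
  have hfin := o.finrank_jacobianSpace hw hconn
  obtain ⟨hdet, hpos⟩ := o.prod_weight_le_latticeDet_jacobian hw h hfin
  have hmin := o.latticeMinNorm_jacobian_nonneg hw
  set b := G.bettiOne
  set Q := ∏ k ∈ Finset.Icc 2 b, Real.logb 2 (8 / 3 * (k : ℝ)) with hQdef
  set D := latticeDet (o.jacobian hw)
  have hQ : 0 ≤ Q := Finset.prod_nonneg fun k hk => by
    have : (2 : ℝ) ≤ k := by exact_mod_cast (Finset.mem_Icc.1 hk).1
    exact Real.logb_nonneg one_lt_two (by linarith)
  have hmain : latticeMinNorm (o.jacobian hw) ^ b ≤ 4 ^ b * Q * D :=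
    (h.pow_le hmin hb hw.nonneg).trans (mul_le_mul_of_nonneg_left hdet (by positivity))
  rw [hermiteInvariant, hfin, div_le_iff₀ (Real.rpow_pos_of_pos hpos _)]
  -- Raising to the b-th power removes both b-th roots.
  refine le_of_pow_le_pow_left₀ (n := b) (by omega) (by positivity) (hmain.trans (le_of_eq ?_))
  rw [mul_pow, mul_pow, one_div, Real.rpow_inv_natCast_pow hQ (by omega),
    Real.rpow_inv_natCast_pow hpos.le (by omega)]

end Orientation

/-! ### The complexity bound and the conclusion -/

theorem systole_pow_div_le_complexity [Fintype E(G)] [Finite V(G)] (hconn : G.IsConnected)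
    (hb : 1 ≤ G.bettiOne) :
    (G.systole : ℝ) ^ G.bettiOne /
        (4 ^ G.bettiOne * ∏ k ∈ Finset.Icc 2 G.bettiOne, Real.logb 2 (8 / 3 * (k : ℝ))) ≤
      (G.complexity : ℝ) := by
  obtain ⟨o⟩ := G.exists_orientation
  have hrank := o.finrank_cycleSpace hconn
  have hne := Orientation.nonempty_edgeSet hconn hb
  obtain ⟨c, l, h⟩ := exists_isHeavyFlag (w := fun _ => 1) (fun _ => zero_le_one) G.bettiOne
    Finset.univ hrank fun z hz hzu hz0 => o.systole_le_sum_sq hz hzu hz0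
  have hcard := o.prod_card_seriesClass_le_complexity hconn h
  have hpow := h.pow_le (Nat.cast_nonneg _) hb fun _ => zero_le_one
  have hQ : 0 < ∏ k ∈ Finset.Icc 2 G.bettiOne, Real.logb 2 (8 / 3 * (k : ℝ)) :=
    Finset.prod_pos fun k hk => by
      have : (2 : ℝ) ≤ k := by exact_mod_cast (Finset.mem_Icc.1 hk).1
      exact Real.logb_pos one_lt_two (by linarith)
  rw [div_le_iff₀' (by positivity)]
  refine hpow.trans (mul_le_mul_of_nonneg_left ?_ (by positivity))
  simp only [Finset.sum_const, nsmul_eq_mul, mul_one]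
  exact_mod_cast hcard

end Graph

theorem mainTheorem2 {α β : Type*} (G : Graph α β)
    [Finite (Graph.vertexSet G)] [Fintype (Graph.edgeSet G)]
    (hconn : G.IsConnected) (hval : ∀ x ∈ Graph.vertexSet G, 2 ≤ G.valence x)
    (hb : 2 ≤ G.bettiOne) :
    (∀ (o : G.Orientation) (w : Graph.edgeSet G → ℝ) (hw : o.IsWeight w),
      hermiteInvariant (o.jacobian hw) ≤
        4 * (∏ k ∈ Finset.Icc 2 G.bettiOne, Real.logb 2 (8 / 3 * (k : ℝ))) ^
          (1 / (G.bettiOne : ℝ))) ∧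
    ((∀ x ∈ Graph.vertexSet G, G.valence x = 2 ∨ G.valence x = 3) →
      (G.systole : ℝ) ^ G.bettiOne /
          (4 ^ G.bettiOne * ∏ k ∈ Finset.Icc 2 G.bettiOne, Real.logb 2 (8 / 3 * (k : ℝ))) ≤
        (G.complexity : ℝ)) := by
  have hb' : 1 ≤ G.bettiOne := one_le_two.trans hb
  exact ⟨fun o w hw => o.hermiteInvariant_jacobian_le hw hconn hb',
    fun _ => Graph.systole_pow_div_le_complexity hconn hb'⟩
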